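/- Let $(\Omega,\Sigma,P)$ be a probability space, and write $P_X$ for the law of a random variable $X$. A counting process is a family $N=\{N_t\}_{t\ge 0}$ of random variables with values in $\mathbb N_0\cup\{\infty\}$ all of whose paths vanish at $0$, are increasing and right-continuous, have jumps of size at most one and tend to infinity; its arrival times are $T_n=\inf\{t: N_t=n\}$ ($n\ge0$) and its interarrival times are $W_n=T_n-T_{n-1}$ ($n\ge1$). Let $\Theta:\Omega\to\mathbb R$ be a random variable with values in a Borel set $D\subseteq\mathbb R$, let $h:D\to\mathbb R$ be Borel measurable, and let $N$ be an extended mixed renewal process eMRP$(\mathbf K(h(\Theta)))$: $N$ is a counting process whose interarrival times are conditionally independent given $\Theta$, and there are probability measures $\mathbf K(h(\theta))$ on $\mathbb R$ ($\theta\in D$) such that for every $n$ the conditional distribution of $W_n$ given $\Theta$ is $\mathbf K(h(\Theta))$ almost surely. A family $\{R_\theta\}_{\theta\in S}$ ($S\subseteq\mathbb R$ Borel) of probability measures on $\Sigma$ is a disintegration of $P$ over $P_X$ consistent with a random variable $X:\Omega\to\mathbb R$ if $\theta\mapsto R_\theta(A)$ is Borel measurable on $S$ and $\int_S R_\theta(A)\,P_X(d\theta)=P(A)$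 for all $A\in\Sigma$, and if for every Borel set $B$ one has $R_\theta(X^{-1}(B))=1$ for $P_X$-almost every $\theta\in B\cap S$. Let $\{P_\theta\}_{\theta\in D}$ be a disintegration of $P$ over $P_\Theta$ consistent with $\Theta$, and put $F_\theta(t)=P_\theta(W_1\le t)$. (For $P_\Theta$-almost every $\theta$ all $W_n$ have the same law under $P_\theta$.) Suppose that there are a Borel set $L_h\subseteq D$ with $P_\Theta(L_h)=0$ and a function $C\in\mathcal L^1(P_{h(\Theta)})$ such that for all $\theta\in D\setminus L_h$ the function $F_\theta$ is continuously differentiable on $(0,\infty)$, $0<F_\theta'(t)<C(h(\theta))$ for all $t>0$, and the limit $p_h(\theta)=\lim_{t\downarrow0}F'_\theta(t)$ exists and is positive, and such that $p_h$ is injective on $D\setminus L_h$. Suppose further that $h$ is injective on $D\setminus L_0$ for some Borel set $L_0\subseteq D$ with $P_\Theta(L_0)=0$. Put $O_h=L_0\cup L_h$, let $\widehat\Theta:\Omega\to\mathbb R$ be any random variable with $\widehat\Theta=p_h\circ\Theta$ on $\Theta^{-1}(D\setminus O_h)$, and for $\widehat\theta\in\mathbb R$ let $Q_{\widehat\theta}=P_\theta$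 if $\widehat\theta=p_h(\theta)$ with $\theta\in D\setminus O_h$, and $Q_{\widehat\theta}=P$ if $\widehat\theta\notin p_h(D\setminus O_h)$. Then $\{Q_{\widehat\theta}\}_{\widehat\theta\in\mathbb R}$ is a disintegration of $P$ over $P_{\widehat\Theta}$ consistent with $\widehat\Theta$, and the following are equivalent: (i) $N$ is a $P$-MPP$(\widehat\Theta)$: $P(\widehat\Theta>0)=1$, under $P$ the increments of $N$ are conditionally independent and conditionally stationary given $\widehat\Theta$, and for each $t>0$ the conditional distribution of $N_t$ given $\widehat\Theta$ is the Poisson distribution with parameter $\widehat\Theta t$, almost surely; (ii) $N$ is a $P$-MPP$(\{Q_{\widehat\theta}\}_{\widehat\theta\in\mathbb R},P_{\widehat\Theta})$: with $\nu$ the restriction of $P_{\widehat\Theta}$ to the $\sigma$-algebra $\sigma(\{Q_\bullet(E):E\in\Sigma\})$ on $\mathbb R$, there is a positive function $\alpha$, measurable for this $\sigma$-algebra, such that for $\nu$-almost every $\widehat\theta$ the $W_n$ are independent and exponentially distributed with parameter $\alpha(\widehat\theta)$ under $Q_{\widehat\theta}$, and $P(\bigcap_{k=1}^r\{W_k\le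 w_k\})=\int\prod_{k=1}^rQ_{\widehat\theta}(W_k\le w_k)\,\nu(d\widehat\theta)$ for all $r\in\mathbb N$ and $w_1,\dots,w_r>0$; (iii) for $P_{\widehat\Theta}$-almost every $\widehat\theta\in\mathbb R$, one has $\widehat\theta>0$ and $N$ is a Poisson process with parameter $\widehat\theta$ under $Q_{\widehat\theta}$ (it has independent stationary increments and $N_t$ is Poisson distributed with parameter $\widehat\theta t$ for each $t>0$); (iv) $N$ is a $P$-MPP$(P_{\widehat\Theta})$: $P_{\widehat\Theta}((0,\infty))=1$ and $$P\Bigl(\bigcap_{j=1}^m\{N_{t_j}-N_{t_{j-1}}=\kappa_j\}\Bigr)=\int_{(0,\infty)}\prod_{j=1}^m e^{-\theta(t_j-t_{j-1})}\frac{(\theta(t_j-t_{j-1}))^{\kappa_j}}{\kappa_j!}\,P_{\widehat\Theta}(d\theta)$$ for all $m\in\mathbb N$, $0=t_0<t_1<\dots<t_m$ and $\kappa_1,\dots,\kappa_m\in\mathbb N_0$. -/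

import Mathlib

open MeasureTheory ProbabilityTheory Set Filter Topology
open scoped NNReal ENNReal

noncomputable section

namespace MixedPoisson

variable {Ω : Type*} [MeasurableSpace Ω]

/-! ### Counting processes -/

/-- A counting process with values in `{0, 1, 2, …} ∪ {∞}`, all of whose paths start at zero, are
increasing and right-continuous, have jumps of size at most one, and increase to infinity.
(The exceptional null set is empty.) Explosion in finite time is allowed. -/
structure IsCountingProcess (N : ℝ≥0 → Ω → EReal) : Prop where
  measurable : ∀ t, Measurable (N t)
  values : ∀ t ω, N t ω = ⊤ ∨ ∃ n : ℕ, N t ω = (n : EReal)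
  zero : ∀ ω, N 0 ω = 0
  mono : ∀ ω, Monotone fun t => N t ω
  right_continuous : ∀ ω t, ContinuousWithinAt (fun s => N s ω) (Ici t) t
  jump_le_one : ∀ ω t, 0 < t → N t ω ≤ (⨆ s ∈ Iio t, N s ω) + 1
  tendsto_top : ∀ ω, Tendsto (fun t => N t ω) atTop (𝓝 ⊤)

/-- The `n`-th arrival time `T_n = inf {t ≥ 0 : N_t = n}`. -/
def arrival (N : ℝ≥0 → Ω → EReal) (n : ℕ) (ω : Ω) : ℝ≥0 :=
  sInf {t : ℝ≥0 | N t ω = (n : EReal)}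

/-- The interarrival times, numbered from zero: `interarrival N n` is
`W_{n+1} = T_{n+1} - T_n`. -/
def interarrival (N : ℝ≥0 → Ω → EReal) (n : ℕ) (ω : Ω) : ℝ :=
  (arrival N (n + 1) ω : ℝ) - (arrival N n ω : ℝ)

/-- The increment `N_{t_{j+1}} - N_{t_j}` along a finite sequence of times. In `EReal` one has
`∞ - ∞ = -∞`, so an undefined increment is never equal to a natural number. -/
def increment (N : ℝ≥0 → Ω → EReal) {m : ℕ} (t : Fin (m + 1) → ℝ≥0) (j : Fin m) (ω : Ω) : EReal :=
  N (t j.succ) ω - N (t j.castSucc) ω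

/-- The times `0 = t_0 < t_1 < ⋯ < t_m`. -/
def IsTimeGrid {m : ℕ} (t : Fin (m + 1) → ℝ≥0) : Prop :=
  t 0 = 0 ∧ StrictMono t

/-- The Poisson distribution with parameter `r`, as a law on the extended reals. -/
def poissonLaw (r : ℝ≥0) : Measure EReal :=
  (poissonMeasure r).map fun n : ℕ => (n : EReal)

/-! ### Conditioning on a random variable -/

/-- The `σ`-algebra `σ(Θ)`. -/
abbrev sigmaOf (Θ : Ω → ℝ) : MeasurableSpace Ω :=
  MeasurableSpace.comap Θ inferInstance

/-- The conditional probability `P(A ∣ σ(Θ))`. -/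
def condProb (P : Measure Ω) (Θ : Ω → ℝ) (A : Set Ω) : Ω → ℝ :=
  P[A.indicator (fun _ => (1 : ℝ)) | sigmaOf Θ]

/-- `P`-conditional independence given `Θ` of a family of random variables. -/
def CondIndep {ι E : Type*} [Preorder E] (P : Measure Ω) (Θ : Ω → ℝ) (X : ι → Ω → E) : Prop :=
  ∀ (s : Finset ι) (x : ι → E),
    condProb P Θ (⋂ i ∈ s, {ω | X i ω ≤ x i}) =ᵐ[P]
      fun ω => ∏ i ∈ s, condProb P Θ {ω' | X i ω' ≤ x i} ω

/-- `κ` is a conditional distribution of `X` over `Θ`. -/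
structure IsCondDistribution {E : Type*} [MeasurableSpace E] (P : Measure Ω) (X : Ω → E)
    (Θ : Ω → ℝ) (κ : Ω → Measure E) : Prop where
  prob : ∀ ω, IsProbabilityMeasure (κ ω)
  measurable : ∀ B, MeasurableSet B → Measurable[sigmaOf Θ] fun ω => κ ω B
  ae_eq : ∀ B, MeasurableSet B → (fun ω => (κ ω).real B) =ᵐ[P] condProb P Θ (X ⁻¹' B)

/-- `P_{X ∣ Θ} = M` holds `P ↾ σ(Θ)`-almost surely, as an equality of measures off one null set
in `σ(Θ)`. -/
def CondLawEq {E : Type*} [MeasurableSpace E] (P : Measure Ω) (X : Ω → E)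
    (Θ : Ω → ℝ) (M : Ω → Measure E) : Prop :=
  ∃ κ : Ω → Measure E, IsCondDistribution P X Θ κ ∧
    ∃ Z : Set Ω, MeasurableSet[sigmaOf Θ] Z ∧ P Z = 0 ∧ ∀ ω ∉ Z, κ ω = M ω

/-- `N` has `P`-conditionally independent increments given `Θ`. -/
def CondIndepIncrements (P : Measure Ω) (N : ℝ≥0 → Ω → EReal) (Θ : Ω → ℝ) : Prop :=
  ∀ (m : ℕ) (t : Fin (m + 1) → ℝ≥0), IsTimeGrid t → CondIndep P Θ (increment N t)

/-- `N` has `P`-conditionally stationary increments given `Θ`: vectors of increments over shifted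
times have the same conditional joint distribution. -/
def CondStationaryIncrements (P : Measure Ω) (N : ℝ≥0 → Ω → EReal) (Θ : Ω → ℝ) : Prop :=
  ∀ (m : ℕ) (t : Fin (m + 1) → ℝ≥0), IsTimeGrid t → ∀ u : ℝ≥0,
    ∀ F : Set Ω, MeasurableSet[sigmaOf Θ] F → ∀ B : Set (Fin m → EReal), MeasurableSet B →
      P (F ∩ {ω | (fun j => increment N (fun i => t i + u) j ω) ∈ B}) =
        P (F ∩ {ω | (fun j => increment N t j ω) ∈ B})

/-! ### Poisson and mixed Poisson processes -/

/-- `N` is a Poisson process with parameter `a > 0` under `P`. -/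
structure IsPoissonProcess (P : Measure Ω) (N : ℝ≥0 → Ω → EReal) (a : ℝ) : Prop where
  counting : IsCountingProcess N
  pos : 0 < a
  indep : ∀ (m : ℕ) (t : Fin (m + 1) → ℝ≥0), IsTimeGrid t → iIndepFun (increment N t) P
  stationary : ∀ (m : ℕ) (t : Fin (m + 1) → ℝ≥0), IsTimeGrid t → ∀ u : ℝ≥0,
    IdentDistrib (fun ω j => increment N (fun i => t i + u) j ω)
      (fun ω j => increment N t j ω) P P
  law : ∀ t : ℝ≥0, 0 < t → P.map (N t) = poissonLaw (a.toNNReal * t)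

/-- `N` is a mixed Poisson process with mixing parameter the random variable `Θ`. -/
structure IsMPP (P : Measure Ω) (N : ℝ≥0 → Ω → EReal) (Θ : Ω → ℝ) : Prop where
  counting : IsCountingProcess N
  measurable : Measurable Θ
  pos : P.map Θ (Ioi 0) = 1
  cond_indep : CondIndepIncrements P N Θ
  cond_stationary : CondStationaryIncrements P N Θ
  cond_law : ∀ t : ℝ≥0, 0 < t →
    CondLawEq P (N t) Θ fun ω => poissonLaw ((Θ ω).toNNReal * t)

/-- The `σ`-algebra on the index set generated by the maps `y ↦ Q_y(E)`, `E` measurable. -/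
abbrev familySigma {Y : Type*} (Q : Y → Measure Ω) : MeasurableSpace Y :=
  ⨆ E : {E : Set Ω // MeasurableSet E}, MeasurableSpace.comap (fun y => Q y E) inferInstance

/-- `N` is a mixed Poisson process associated with the family `{Q_y}` of probability measures and
the probability measure `ν` on the `σ`-algebra generated by the maps `y ↦ Q_y(E)`. -/
structure IsMPPFamily {Y : Type*} (P : Measure Ω) (N : ℝ≥0 → Ω → EReal) (Q : Y → Measure Ω)
    (ν : @Measure Y (familySigma Q)) : Prop where
  counting : IsCountingProcess N
  prob : ∀ y, IsProbabilityMeasure (Q y)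
  prob_mixing : ν univ = 1
  exponential : ∃ α : Y → ℝ, (∀ y, 0 < α y) ∧ Measurable[familySigma Q] α ∧
    ∀ᵐ y ∂ν, iIndepFun (interarrival N) (Q y) ∧
      ∀ n, (Q y).map (interarrival N n) = expMeasure (α y)
  mixture : ∀ (r : ℕ) (w : Fin r → ℝ), (∀ k, 0 < w k) →
    P (⋂ k : Fin r, {ω | interarrival N k ω ≤ w k}) =
      @lintegral Y (familySigma Q) ν fun y => ∏ k : Fin r, Q y {ω | interarrival N k ω ≤ w k}

/-- `N` is a mixed Poisson process with mixing distribution `U` on `(0, ∞)`. -/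
structure IsMPPDistribution (P : Measure Ω) (N : ℝ≥0 → Ω → EReal) (U : Measure ℝ) : Prop where
  counting : IsCountingProcess N
  prob : IsProbabilityMeasure U
  pos : U (Ioi 0) = 1
  mixture : ∀ (m : ℕ) (t : Fin (m + 1) → ℝ≥0), IsTimeGrid t → ∀ k : Fin m → ℕ,
    P.real (⋂ j, {ω | increment N t j ω = (k j : EReal)}) =
      ∫ θ in Ioi 0, ∏ j : Fin m,
        (Real.exp (-(θ * ((t j.succ : ℝ) - (t j.castSucc : ℝ)))) *
          (θ * ((t j.succ : ℝ) - (t j.castSucc : ℝ))) ^ k j / ((k j).factorial : ℝ)) ∂U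

/-! ### Extended mixed renewal processes and disintegrations -/

/-- `N` is an extended mixed renewal process with mixing parameters `Θ` and `h` and interarrival
time conditional distribution `K(h(Θ))`. Only the values of `h` on `D` and of `K` on `h(D)`
matter. -/
structure IsEMRP (P : Measure Ω) (N : ℝ≥0 → Ω → EReal) (Θ : Ω → ℝ) (D : Set ℝ) (h : ℝ → ℝ)
    (K : ℝ → Measure ℝ) : Prop where
  counting : IsCountingProcess N
  measurableSet : MeasurableSet D
  range_subset : ∀ ω, Θ ω ∈ D
  measurable : Measurable fun θ : D => h θ
  prob : ∀ θ ∈ D, IsProbabilityMeasure (K (h θ))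
  cond_indep : CondIndep P Θ (interarrival N)
  cond_law : ∀ n, CondLawEq P (interarrival N n) Θ fun ω => K (h (Θ ω))

/-- The family `{R_θ}`, `θ ∈ D`, is a disintegration of `P` over `ν`. -/
structure IsDisintegration (P : Measure Ω) (ν : Measure ℝ) (D : Set ℝ) (R : ℝ → Measure Ω) :
    Prop where
  prob : ∀ θ ∈ D, IsProbabilityMeasure (R θ)
  measurable : ∀ A, MeasurableSet A → Measurable fun θ : D => R θ A
  lintegral_eq : ∀ A, MeasurableSet A → ∫⁻ θ in D, R θ A ∂ν = P A

/-- The family `{R_θ}`, `θ ∈ D`, is a disintegration of `P` over `ν` consistent with `Θ`. -/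
structure IsConsistentDisintegration (P : Measure Ω) (ν : Measure ℝ) (Θ : Ω → ℝ) (D : Set ℝ)
    (R : ℝ → Measure Ω) : Prop extends IsDisintegration P ν D R where
  map_eq : P.map Θ = ν
  consistent : ∀ B, MeasurableSet B → ∀ᵐ θ ∂ν, θ ∈ D → θ ∈ B → R θ (Θ ⁻¹' B) = 1

/-- The distribution function of the first interarrival time under `R_θ`. For an extended mixed
renewal process and a consistent disintegration all interarrival times have the same law under
`R_θ` for almost all `θ`. -/
def interarrivalCDF (N : ℝ≥0 → Ω → EReal) (R : ℝ → Measure Ω) (θ t : ℝ) : ℝ :=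
  (R θ).real {ω | interarrival N 0 ω ≤ t}

/-- The limit `p(θ)` of the interarrival density under `R_θ` as `t ↓ 0`. -/
def initialDensity (N : ℝ≥0 → Ω → EReal) (R : ℝ → Measure Ω) (θ : ℝ) : ℝ :=
  limUnder (𝓝[>] 0) (deriv (interarrivalCDF N R θ))

/-- The regularity assumption on `N`, `h` and `{R_θ}`, `θ ∈ D`, with exceptional null set `L`. -/
structure DensityAssumption (P : Measure Ω) (N : ℝ≥0 → Ω → EReal) (Θ : Ω → ℝ) (D : Set ℝ)
    (h : ℝ → ℝ) (R : ℝ → Measure Ω) (L : Set ℝ) : Prop where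
  subset : L ⊆ D
  measurableSet : MeasurableSet L
  null : P.map Θ L = 0
  contDiff : ∀ θ ∈ D \ L, ContDiffOn ℝ 1 (interarrivalCDF N R θ) (Ioi 0)
  bound : ∃ C : ℝ → ℝ, Integrable C (P.map fun ω => h (Θ ω)) ∧
    ∀ θ ∈ D \ L, ∀ t > 0,
      0 < deriv (interarrivalCDF N R θ) t ∧ deriv (interarrivalCDF N R θ) t < C (h θ)
  tendsto : ∀ θ ∈ D \ L,
    Tendsto (deriv (interarrivalCDF N R θ)) (𝓝[>] 0) (𝓝 (initialDensity N R θ))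
  pos : ∀ θ ∈ D \ L, 0 < initialDensity N R θ
  injective : InjOn (initialDensity N R) (D \ L)

open Classical in
/-- The family `{R_θ}`, `θ ∈ S`, transported along a map `p` that is injective on `S`:
`Q_y = R_θ` if `y = p(θ)` with `θ ∈ S`, and `Q_y = P` if `y ∉ p(S)`. -/
def transport (P : Measure Ω) (R : ℝ → Measure Ω) (p : ℝ → ℝ) (S : Set ℝ) (y : ℝ) : Measure Ω :=
  if y ∈ p '' S then R (Function.invFunOn p S y) else P

end MixedPoisson

end

/-! All four statements are equivalent to one: for almost every `y` the interarrival times are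
independent and exponential with parameter `y` under `Q y`. Two facts are available beforehand.
Conditional probabilities given `Θ` are computed by the disintegration, so the renewal hypothesis
makes the interarrival times independent and identically distributed under almost every `Q y`
(`IsEMRP.ae_iid`). The new parameter is the initial density, so the density of the first
interarrival time under `Q y` tends to `y` at `0`; hence `y` is the only possible exponential
parameter (`eq_of_tendsto_deriv`). That `Q` is a disintegration at all rests on the theorem that
injective Borel images of Borel sets are Borel.

The implications run (i) → (iv) → (ii) → (iii) → (i). Integrating the conditional Poisson laws gives
(iv).

From (iv) to exponential times (`ae_exponential_of_isMPPDistribution`): the joint laws of the counts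
determine the law of the interarrival sequence, which is therefore a mixture of exponential product
laws over the law `U` of the parameter. With `G y t` the survival function under `Q y`, comparison
with the disintegration shows that products of values `G y (a i)` and products of `exp (-(y * a i))`
have the same integral over `U`. These are only moments, but the square of `G y (s + t) - G y s * G
y t` expands into such products, so its integral equals the exponential one, which is `0`. Thus `G
y` is multiplicative for almost every `y`, and the behaviour at `0` forces `G y t = exp (-(y * t))`.

From exponential times to (ii), the parameter is recovered measurably as `-log (Q y {W₁ > 1})`. From
(ii) to (iii), the initial density identifies the parameter with `y`, and lack of memory
(`infinitePi_residual`) yields Poisson increments. From (iii) to (i), consistency makes `Q`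
evaluated at the parameter a version of the conditional probability. -/

namespace MixedPoisson

variable {Ω : Type*} [MeasurableSpace Ω]

/-! ### Paths of counting processes and their arrival times. -/

namespace IsCountingProcess

variable {N : ℝ≥0 → Ω → EReal}

/-- Right-continuity makes the infimum of `{t | n ≤ N t}` a minimum. Strictly before it the
integer-valued path is at most `n - 1`, so the bound on the jumps gives exactly `n` there: no level
is skipped, and `arrival`, defined by `N t = n`, is also the first time with `n ≤ N t`. -/
theorem isLeast_level (hN : IsCountingProcess N) (n : ℕ) (ω : Ω) :
    IsLeast {t | (n : EReal) ≤ N t ω} (arrival N n ω) ∧ N (arrival N n ω) ω = n := by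
  set A : Set ℝ≥0 := {t | (n : EReal) ≤ N t ω} with hA
  have hne : A.Nonempty := by
    have htop : (n : EReal) < ⊤ := EReal.coe_lt_top (n : ℝ)
    have := (hN.tendsto_top ω).eventually (lt_mem_nhds htop)
    obtain ⟨t, ht⟩ := this.exists
    exact ⟨t, ht.le⟩
  have hbdd : BddBelow A := OrderBot.bddBelow A
  have hmem : sInf A ∈ A := by
    by_contra hτ
    have hlt : N (sInf A) ω < n := not_le.1 hτ
    have hev := (hN.right_continuous ω (sInf A)).eventually (gt_mem_nhds hlt)
    obtain ⟨u, hu, hsub⟩ := mem_nhdsGE_iff_exists_Ico_subset.1 hev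
    obtain ⟨s, hsA, hsu⟩ := exists_lt_of_csInf_lt hne hu
    have : N s ω < n := hsub ⟨csInf_le hbdd hsA, hsu⟩
    exact absurd this (not_lt.2 hsA)
  have heq : N (sInf A) ω = n := by
    refine le_antisymm ?_ hmem
    rcases eq_or_ne (sInf A) 0 with h0 | h0
    · rw [h0, hN.zero]
      exact_mod_cast Nat.zero_le n
    · have hpos : 0 < sInf A := pos_iff_ne_zero.2 h0
      have hn : n ≠ 0 := by
        rintro rfl
        have : (0 : ℝ≥0) ∈ A := by simp [hA, hN.zero]
        exact absurd (csInf_le hbdd this) (not_le.2 hpos)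
      obtain ⟨k, rfl⟩ := Nat.exists_eq_succ_of_ne_zero hn
      refine (hN.jump_le_one ω _ hpos).trans ?_
      have : (⨆ s ∈ Iio (sInf A), N s ω) ≤ (k : EReal) := by
        refine iSup₂_le fun s hs => ?_
        have hs' : N s ω < ((k + 1 : ℕ) : EReal) := by
          by_contra hcon
          exact absurd (csInf_le hbdd (not_lt.1 hcon)) (not_le.2 hs)
        rcases hN.values s ω with h | ⟨m, h⟩
        · rw [h] at hs'; exact absurd hs' not_top_lt
        · rw [h] at hs' ⊢
          have : m < k + 1 := by exact_mod_cast hs'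
          exact_mod_cast Nat.lt_succ_iff.1 this
      calc _ ≤ (k : EReal) + 1 := by gcongr
        _ = ((k.succ : ℕ) : EReal) := by push_cast; rfl
  have harr : arrival N n ω = sInf A := by
    refine le_antisymm (csInf_le (OrderBot.bddBelow _) heq) ?_
    exact csInf_le_csInf hbdd ⟨_, heq⟩ fun t ht => (show N t ω = n from ht).ge
  rw [harr]
  exact ⟨⟨hmem, fun t ht => csInf_le hbdd ht⟩, heq⟩

theorem natCast_le_iff (hN : IsCountingProcess N) (n : ℕ) (t : ℝ≥0) (ω : Ω) :
    (n : EReal) ≤ N t ω ↔ arrival N n ω ≤ t :=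
  ⟨fun h => (hN.isLeast_level n ω).1.2 h,
    fun h => (hN.isLeast_level n ω).2.ge.trans (hN.mono ω h)⟩

/-- Translates counts into arrival times; every later passage between increments and waiting times
goes through this equivalence. -/
theorem eq_natCast_iff (hN : IsCountingProcess N) (n : ℕ) (t : ℝ≥0) (ω : Ω) :
    N t ω = n ↔ arrival N n ω ≤ t ∧ t < arrival N (n + 1) ω := by
  rw [← hN.natCast_le_iff, ← not_le, ← hN.natCast_le_iff]
  rcases hN.values t ω with h | ⟨m, h⟩
  · simpa [h] using (EReal.natCast_ne_top n).symm
  · rw [h]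
    simp only [not_le]
    norm_cast
    omega

theorem arrival_zero (hN : IsCountingProcess N) (ω : Ω) : arrival N 0 ω = 0 := by
  have : arrival N 0 ω ≤ 0 := by
    rw [← hN.natCast_le_iff, hN.zero]; simp
  exact le_antisymm this zero_le

theorem arrival_lt_succ (hN : IsCountingProcess N) (n : ℕ) (ω : Ω) :
    arrival N n ω < arrival N (n + 1) ω :=
  ((hN.eq_natCast_iff n _ ω).1 (hN.isLeast_level n ω).2).2

theorem interarrival_pos (hN : IsCountingProcess N) (n : ℕ) (ω : Ω) :
    0 < interarrival N n ω :=
  sub_pos.2 (by exact_mod_cast hN.arrival_lt_succ n ω)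

theorem sum_interarrival (hN : IsCountingProcess N) (n : ℕ) (ω : Ω) :
    ∑ i ∈ Finset.range n, interarrival N i ω = arrival N n ω := by
  have := Finset.sum_range_sub (fun i => (arrival N i ω : ℝ)) n
  simpa [interarrival, hN.arrival_zero] using this

theorem measurable_arrival (hN : IsCountingProcess N) (n : ℕ) : Measurable (arrival N n) := by
  refine measurable_of_Iic fun t => ?_
  have : arrival N n ⁻¹' Iic t = N t ⁻¹' Ici (n : EReal) := by
    ext ω
    exact (hN.natCast_le_iff n t ω).symm
  rw [this]
  exact hN.measurable t measurableSet_Ici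

theorem measurable_interarrival (hN : IsCountingProcess N) (n : ℕ) :
    Measurable (interarrival N n) :=
  (hN.measurable_arrival (n + 1)).coe_nnreal_real.sub (hN.measurable_arrival n).coe_nnreal_real

theorem measurable_interarrivals (hN : IsCountingProcess N) :
    Measurable fun ω n => interarrival N n ω :=
  measurable_pi_iff.2 hN.measurable_interarrival

theorem measurable_increment (hN : IsCountingProcess N) {m : ℕ} (t : Fin (m + 1) → ℝ≥0)
    (j : Fin m) : Measurable (increment N t j) := by
  have h : Measurable fun ω => -N (t j.castSucc) ω := (hN.measurable _).neg
  exact (hN.measurable (t j.succ)).add h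

theorem measurable_increments (hN : IsCountingProcess N) {m : ℕ} (t : Fin (m + 1) → ℝ≥0) :
    Measurable fun ω j => increment N t j ω :=
  measurable_pi_iff.2 (hN.measurable_increment t)

end IsCountingProcess

end MixedPoisson

noncomputable section

namespace MixedPoisson

/-! ### Sequences of waiting times -/

/-- The partial sums of a sequence of waiting times. -/
def partialSum (w : ℕ → ℝ) (n : ℕ) : ℝ := ∑ i ∈ Finset.range n, w i

/-- The waiting times seen from time `s`, if `k` arrivals have taken place up to time `s`. -/
def residual (s : ℝ) (k : ℕ) (w : ℕ → ℝ) : ℕ → ℝ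
  | 0 => partialSum w (k + 1) - s
  | i + 1 => w (k + 1 + i)

/-- The sequence that starts with `x` and continues with `w`. -/
def consSeq (x : ℝ) (w : ℕ → ℝ) : ℕ → ℝ
  | 0 => x
  | i + 1 => w i

/-- The sequences of waiting times with `k j` arrivals in each of the intervals
`(t j - t 0, t (j + 1) - t 0]`. -/
def countEvent : (m : ℕ) → (Fin (m + 1) → ℝ≥0) → (Fin m → ℕ) → Set (ℕ → ℝ)
  | 0, _, _ => univ
  | m + 1, t, k => {w | partialSum w (k 0) ≤ (t 1 : ℝ) - t 0 ∧
      (t 1 : ℝ) - t 0 < partialSum w (k 0 + 1) ∧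
      residual ((t 1 : ℝ) - t 0) (k 0) w ∈
        countEvent m (fun i => t i.succ) (fun j => k j.succ)}

/-- The weight `e⁻ᵃ aᵏ / k!` of the Poisson distribution. -/
def poissonWeight (a : ℝ) (k : ℕ) : ℝ := Real.exp (-a) * a ^ k / (k.factorial : ℝ)

theorem poissonWeight_nonneg {a : ℝ} (ha : 0 ≤ a) (k : ℕ) : 0 ≤ poissonWeight a k := by
  unfold poissonWeight; positivity

theorem measurable_poissonWeight (k : ℕ) : Measurable fun a => poissonWeight a k := by
  unfold poissonWeight; fun_prop

@[simp] theorem partialSum_zero (w : ℕ → ℝ) : partialSum w 0 = 0 := rfl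

theorem partialSum_succ (w : ℕ → ℝ) (n : ℕ) : partialSum w (n + 1) = partialSum w n + w n :=
  Finset.sum_range_succ _ _

theorem measurable_partialSum (n : ℕ) : Measurable fun w => partialSum w n := by
  unfold partialSum; fun_prop

theorem measurable_residual (s : ℝ) (k : ℕ) : Measurable (residual s k) := by
  refine measurable_pi_iff.2 fun i => ?_
  cases i with
  | zero => exact (measurable_partialSum (k + 1)).sub_const s
  | succ i => exact measurable_pi_apply (k + 1 + i)

theorem measurable_consSeq : Measurable fun p : ℝ × (ℕ → ℝ) => consSeq p.1 p.2 := by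
  refine measurable_pi_iff.2 fun i => ?_
  cases i with
  | zero => exact measurable_fst
  | succ i => exact (measurable_pi_apply i).comp measurable_snd

theorem measurableSet_countEvent (m : ℕ) (t : Fin (m + 1) → ℝ≥0) (k : Fin m → ℕ) :
    MeasurableSet (countEvent m t k) := by
  induction m with
  | zero => exact MeasurableSet.univ
  | succ m ih =>
    exact (measurableSet_le (measurable_partialSum _) measurable_const).inter
      ((measurableSet_lt measurable_const (measurable_partialSum _)).inter
        (measurable_residual _ _ (ih _ _)))

theorem partialSum_consSeq (x : ℝ) (w : ℕ → ℝ) (n : ℕ) :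
    partialSum (consSeq x w) (n + 1) = x + partialSum w n := by
  simp [partialSum, Finset.sum_range_succ', consSeq, add_comm]

theorem residual_consSeq_zero (s x : ℝ) (w : ℕ → ℝ) :
    residual s 0 (consSeq x w) = consSeq (x - s) w := by
  funext i
  cases i with
  | zero => simp [residual, partialSum_consSeq, consSeq]
  | succ i => simp [residual, consSeq, add_comm 1 i]

theorem residual_consSeq_succ (s x : ℝ) (k : ℕ) (w : ℕ → ℝ) :
    residual s (k + 1) (consSeq x w) = residual (s - x) k w := by
  funext i
  cases i with
  | zero => simp only [residual, partialSum_consSeq]; ring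
  | succ i =>
    have : k + 1 + 1 + i = (k + 1 + i) + 1 := by omega
    simp only [residual, this, consSeq]

/-- The residual arrival times are the arrival times numbered beyond `k`, measured from `s`. The
index `n + 1` is needed: the empty sum is `0`, not `partialSum w k - s`. -/
theorem partialSum_residual (s : ℝ) (k : ℕ) (w : ℕ → ℝ) (n : ℕ) :
    partialSum (residual s k w) (n + 1) = partialSum w (k + n + 1) - s := by
  induction n with
  | zero => simp [partialSum_succ (residual s k w), residual]
  | succ n ih =>
    rw [partialSum_succ, ih, ← add_assoc, partialSum_succ w (k + n + 1)]
    simp only [residual]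
    rw [show k + 1 + n = k + n + 1 by omega]
    ring

/-- Restarting twice is restarting once at the later time. This is what lets inductions over
successive intervals return to the original sequence. -/
theorem residual_residual (s u : ℝ) (k n : ℕ) (w : ℕ → ℝ) :
    residual s k (residual u n w) = residual (u + s) (n + k) w := by
  funext i
  cases i with
  | zero =>
    simp only [residual, partialSum_residual]
    rw [add_assoc]; ring
  | succ i =>
    have : k + 1 + i = (k + i) + 1 := by omega
    simp only [residual, this]
    congr 1; omega

theorem residual_zero_zero (w : ℕ → ℝ) : residual 0 0 w = w := by
  funext i
  cases i with
  | zero => simp [residual, partialSum]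
  | succ i => simp [residual, add_comm]

theorem IsCountingProcess.partialSum_interarrival {Ω : Type*} [MeasurableSpace Ω]
    {N : ℝ≥0 → Ω → EReal} (hN : IsCountingProcess N) (n : ℕ) (ω : Ω) :
    partialSum (fun i => interarrival N i ω) n = arrival N n ω :=
  hN.sum_interarrival n ω

/-- Induction over the intervals, with the starting count `n` and the starting time `t 0` left
general: after the first interval the process has made `n + k 0` jumps by time `t 1`, and the same
statement applies from there. -/
theorem IsCountingProcess.increment_eq_iff {Ω : Type*} [MeasurableSpace Ω]
    {N : ℝ≥0 → Ω → EReal} (hN : IsCountingProcess N) (ω : Ω) (m : ℕ) (t : Fin (m + 1) → ℝ≥0)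
    (ht : Monotone t) (n : ℕ) (hn : N (t 0) ω = n) (k : Fin m → ℕ) :
    (∀ j, increment N t j ω = k j) ↔
      residual (t 0) n (fun i => interarrival N i ω) ∈ countEvent m t k := by
  induction m generalizing n with
  | zero => simp [countEvent]
  | succ m ih =>
    have h01 : t 0 ≤ t 1 := ht (Fin.zero_le 1)
    have hinc : increment N t 0 ω = k 0 ↔ N (t 1) ω = ((n + k 0 : ℕ) : EReal) := by
      have : increment N t 0 ω = N (t 1) ω - n := by rw [← hn]; rfl
      rw [this]
      rcases hN.values (t 1) ω with h | ⟨a, h⟩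
      · rw [h]
        -- After an explosion both sides fail, as `⊤ - n = ⊤` is not a natural number.
        have h1 : (⊤ : EReal) - (n : EReal) = ⊤ := EReal.top_sub_coe (n : ℝ)
        rw [h1]
        exact ⟨fun h => absurd h.symm (EReal.natCast_ne_top _),
          fun h => absurd h.symm (EReal.natCast_ne_top _)⟩
      · rw [h]
        have h1 : (a : EReal) - (n : EReal) = (((a : ℝ) - n : ℝ) : EReal) := by
          rw [EReal.coe_sub]; rfl
        have h2 : ((k 0 : ℕ) : EReal) = (((k 0 : ℕ) : ℝ) : EReal) := rfl
        have h3 : ((n + k 0 : ℕ) : EReal) = (((n + k 0 : ℕ) : ℝ) : EReal) := rfl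
        have h4 : (a : EReal) = ((a : ℝ) : EReal) := rfl
        rw [h1, h2, h3, h4, EReal.coe_eq_coe_iff, EReal.coe_eq_coe_iff]
        push_cast
        constructor <;> intro h <;> linarith
    have hnT := (hN.eq_natCast_iff n _ ω).1 hn
    have hsum : N (t 1) ω = ((n + k 0 : ℕ) : EReal) ↔
        partialSum (residual (t 0) n fun i => interarrival N i ω) (k 0) ≤ (t 1 : ℝ) - t 0 ∧
        (t 1 : ℝ) - t 0 <
          partialSum (residual (t 0) n fun i => interarrival N i ω) (k 0 + 1) := by
      rw [hN.eq_natCast_iff, partialSum_residual, hN.partialSum_interarrival]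
      refine and_congr ?_ ?_
      -- For `k 0 = 0` both sides hold automatically: the empty sum is `0`, and `N (t 0) = n`
      -- already places the `n`-th arrival no later than `t 0`.
      · cases hk : k 0 with
        | zero =>
          simp only [add_zero, partialSum_zero, sub_nonneg, NNReal.coe_le_coe]
          exact ⟨fun _ => h01, fun _ => hnT.1.trans h01⟩
        | succ a =>
          rw [partialSum_residual, hN.partialSum_interarrival, sub_le_sub_iff_right,
            NNReal.coe_le_coe]
          rfl
      · rw [sub_lt_sub_iff_right, NNReal.coe_lt_coe]
    have htail : Monotone fun i : Fin (m + 1) => t i.succ :=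
      fun a b hab => ht (Fin.succ_le_succ_iff.2 hab)
    rw [Fin.forall_fin_succ, hinc]
    change _ ↔ _ ∧ _ ∧ _
    rw [← and_assoc, ← hsum]
    refine and_congr_right fun h1 => ?_
    rw [residual_residual, add_sub_cancel]
    exact ih (fun i => t i.succ) htail (n + k 0) h1 (fun j => k j.succ)

theorem IsCountingProcess.setOf_increment_eq {Ω : Type*} [MeasurableSpace Ω]
    {N : ℝ≥0 → Ω → EReal} (hN : IsCountingProcess N) {m : ℕ} {t : Fin (m + 1) → ℝ≥0}
    (ht : IsTimeGrid t) (k : Fin m → ℕ) :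
    (⋂ j, {ω | increment N t j ω = (k j : EReal)}) =
      (fun ω i => interarrival N i ω) ⁻¹' countEvent m t k := by
  ext ω
  have h0 : N (t 0) ω = (0 : ℕ) := by rw [ht.1, hN.zero]; simp
  have := hN.increment_eq_iff ω m t ht.2.monotone 0 h0 k
  rw [ht.1, NNReal.coe_zero, residual_zero_zero] at this
  simpa using this

/-! ### Exponential waiting times -/

/-- Prepending an independent copy does not change an i.i.d. sequence in law. This is the tool for
conditioning on the first waiting time. -/
theorem infinitePi_eq_map_consSeq (ν : Measure ℝ) [IsProbabilityMeasure ν] :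
    (ν.prod (Measure.infinitePi fun _ : ℕ => ν)).map (fun p => consSeq p.1 p.2) =
      Measure.infinitePi fun _ : ℕ => ν := by
  classical
  refine Measure.eq_infinitePi _ fun s t ht => ?_
  obtain ⟨n, hn⟩ : ∃ n, s ⊆ Finset.range (n + 1) := by
    obtain ⟨n, hn⟩ := s.exists_nat_subset_range
    exact ⟨n, hn.trans (Finset.range_subset_range.2 n.le_succ)⟩
  -- Filling the missing coordinates with `univ` turns the box over `s` into one over an initial
  -- segment, where coordinate `0` can be split off.
  set t' : ℕ → Set ℝ := fun i => if i ∈ s then t i else univ with ht'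
  have hm : ∀ i, MeasurableSet (t' i) := fun i => by
    simp only [ht']; split_ifs
    exacts [ht i, MeasurableSet.univ]
  have hpre : (fun p : ℝ × (ℕ → ℝ) => consSeq p.1 p.2) ⁻¹' (Set.pi s t) =
      t' 0 ×ˢ Set.pi (Finset.range n) fun i => t' (i + 1) := by
    ext ⟨x, w⟩
    simp only [mem_preimage, Set.mem_pi, Finset.mem_coe, mem_prod, ht', Finset.mem_range]
    constructor
    · intro h
      refine ⟨?_, fun i _ => ?_⟩
      · split_ifs with h0
        exacts [h 0 h0, mem_univ _]
      · split_ifs with h0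
        exacts [h (i + 1) h0, mem_univ _]
    · rintro ⟨h0, h1⟩ i hi
      cases i with
      | zero => simpa [hi, consSeq] using h0
      | succ i =>
        have := Finset.mem_range.1 (hn hi)
        simpa [hi, consSeq] using h1 i (by omega)
  rw [Measure.map_apply measurable_consSeq (MeasurableSet.pi s.countable_toSet fun i _ => ht i),
    hpre, Measure.prod_prod, Measure.infinitePi_pi _ fun i _ => hm (i + 1)]
  have : ∏ i ∈ s, ν (t i) = ∏ i ∈ Finset.range (n + 1), ν (t' i) := by
    rw [← Finset.prod_subset hn (f := fun i => ν (t' i))]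
    · exact Finset.prod_congr rfl fun i hi => by simp [ht', hi]
    · intro i _ hi; simp [ht', hi]
  rw [this, Finset.prod_range_succ', mul_comm]

theorem infinitePi_apply_consSeq (ν : Measure ℝ) [IsProbabilityMeasure ν] {F : Set (ℕ → ℝ)}
    (hF : MeasurableSet F) :
    Measure.infinitePi (fun _ : ℕ => ν) F =
      ∫⁻ x, Measure.infinitePi (fun _ : ℕ => ν) {w | consSeq x w ∈ F} ∂ν := by
  conv_lhs => rw [← infinitePi_eq_map_consSeq ν]
  rw [Measure.map_apply measurable_consSeq hF, Measure.prod_apply (measurable_consSeq hF)]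
  rfl

theorem measurable_infinitePi_consSeq (ν : Measure ℝ) [IsProbabilityMeasure ν] {F : Set (ℕ → ℝ)}
    (hF : MeasurableSet F) :
    Measurable fun x => Measure.infinitePi (fun _ : ℕ => ν) {w | consSeq x w ∈ F} :=
  measurable_measure_prodMk_left (measurable_consSeq hF)

theorem lintegral_expMeasure {r : ℝ} {g : ℝ → ℝ≥0∞} (hg : Measurable g) :
    ∫⁻ x, g x ∂expMeasure r =
      ∫⁻ x in Ioi 0, ENNReal.ofReal (r * Real.exp (-(r * x))) * g x := by
  have hpdf : Measurable (exponentialPDF r) :=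
    (measurable_exponentialPDFReal r).ennreal_ofReal
  have : expMeasure r = volume.withDensity (exponentialPDF r) := rfl
  rw [this, lintegral_withDensity_eq_lintegral_mul _ hpdf hg,
    ← lintegral_indicator measurableSet_Ioi]
  refine lintegral_congr_ae ?_
  have : ∀ᵐ x : ℝ, x ≠ 0 := by simp [ae_iff]
  filter_upwards [this] with x hx
  rcases lt_or_gt_of_ne hx with h | h
  · simp [exponentialPDF_of_neg h, h.le]
  · simp [exponentialPDF_of_nonneg h.le, h]

/-- Lack of memory: translation by `s` multiplies the exponential density by `exp (-(r * s))`. -/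
theorem lintegral_expMeasure_shift {r : ℝ} {s : ℝ} (hs : 0 ≤ s) {g : ℝ → ℝ≥0∞}
    (hg : Measurable g) :
    ∫⁻ x, (Ioi s).indicator (fun x => g (x - s)) x ∂expMeasure r =
      ENNReal.ofReal (Real.exp (-(r * s))) * ∫⁻ x, g x ∂expMeasure r := by
  have hgs : Measurable fun x => g (x - s) := by fun_prop
  rw [lintegral_expMeasure (hgs.indicator measurableSet_Ioi),
    lintegral_expMeasure hg, ← lintegral_indicator measurableSet_Ioi,
    ← lintegral_indicator measurableSet_Ioi, ← lintegral_const_mul' _ _ ENNReal.ofReal_ne_top,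
    ← lintegral_add_right_eq_self _ s]
  refine lintegral_congr fun x => ?_
  by_cases hx : 0 < x
  · have h1 : 0 < x + s := by linarith
    have h2 : s < x + s := by linarith
    simp only [indicator, mem_Ioi, h1, h2, hx, if_true, add_sub_cancel_right]
    rw [← mul_assoc, ← ENNReal.ofReal_mul (Real.exp_pos _).le]
    congr 2
    rw [mul_left_comm, ← Real.exp_add]
    congr 2; ring
  · have h2 : ¬ s < x + s := by linarith
    simp [indicator, h2, hx]

theorem expMeasure_Ioi {r : ℝ} (hr : 0 < r) {s : ℝ} (hs : 0 ≤ s) :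
    expMeasure r (Ioi s) = ENNReal.ofReal (Real.exp (-(r * s))) := by
  have := isProbabilityMeasure_expMeasure hr
  have h := lintegral_expMeasure_shift (r := r) hs (g := fun _ => 1) measurable_const
  simpa [lintegral_indicator measurableSet_Ioi] using h

theorem ae_expMeasure_pos {r : ℝ} (hr : 0 < r) : ∀ᵐ x ∂expMeasure r, 0 < x := by
  have := isProbabilityMeasure_expMeasure hr
  have h := expMeasure_Ioi hr le_rfl
  rw [mul_zero, neg_zero, Real.exp_zero, ENNReal.ofReal_one] at h
  exact (prob_compl_eq_zero_iff measurableSet_Ioi).2 h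

theorem ae_infinitePi_pos {r : ℝ} (hr : 0 < r) [IsProbabilityMeasure (expMeasure r)] :
    ∀ᵐ w ∂Measure.infinitePi (fun _ : ℕ => expMeasure r), ∀ n, 0 < w n := by
  refine ae_all_iff.2 fun n => ?_
  have := (measurePreserving_eval_infinitePi (fun _ : ℕ => expMeasure r) n)
  exact this.quasiMeasurePreserving.ae (ae_expMeasure_pos hr)

/-- The recursion of the Poisson weights obtained by conditioning on the first arrival at `x`: the
exponential factors combine to `exp (-(r * s))`, and integrating `(s - x) ^ k` over `(0, s]` raises
the power by one. -/
theorem lintegral_expMeasure_poissonWeight {r : ℝ} (hr : 0 < r) {s : ℝ} (hs : 0 ≤ s) (k : ℕ) :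
    ∫⁻ x, (Iic s).indicator (fun x => ENNReal.ofReal (poissonWeight (r * (s - x)) k)) x
        ∂expMeasure r = ENNReal.ofReal (poissonWeight (r * s) (k + 1)) := by
  have hmeas : Measurable fun x => ENNReal.ofReal (poissonWeight (r * (s - x)) k) :=
    ((measurable_poissonWeight k).comp
      (by fun_prop : Measurable fun x => r * (s - x))).ennreal_ofReal
  rw [lintegral_expMeasure (hmeas.indicator measurableSet_Iic)]
  set f : ℝ → ℝ := fun x => r ^ (k + 1) * Real.exp (-(r * s)) / (k.factorial : ℝ) * (s - x) ^ k
    with hf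
  have h1 : ∫⁻ x in Ioi 0, ENNReal.ofReal (r * Real.exp (-(r * x))) *
      (Iic s).indicator (fun x => ENNReal.ofReal (poissonWeight (r * (s - x)) k)) x =
      ∫⁻ x in Ioc 0 s, ENNReal.ofReal (f x) := by
    rw [← Ioi_inter_Iic, inter_comm, ← setLIntegral_indicator measurableSet_Iic]
    refine lintegral_congr fun x => ?_
    by_cases hx : x ∈ Iic s
    · simp only [hx, indicator_of_mem]
      rw [← ENNReal.ofReal_mul (by positivity)]
      congr 1
      simp only [hf, poissonWeight]
      have : Real.exp (-(r * s)) = Real.exp (-(r * x)) * Real.exp (-(r * (s - x))) := by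
        rw [← Real.exp_add]; congr 1; ring
      rw [this, mul_pow]; ring
    · simp [hx]
  rw [h1, ← ofReal_integral_eq_lintegral_ofReal]
  · congr 1
    rw [← intervalIntegral.integral_of_le hs]
    simp only [hf]
    rw [intervalIntegral.integral_const_mul,
      intervalIntegral.integral_comp_sub_left (fun x => x ^ k) s, sub_self, sub_zero, integral_pow]
    simp only [poissonWeight, Nat.factorial_succ]
    push_cast
    field_simp
    ring
  · have : Continuous f := by simp only [hf]; fun_prop
    exact (this.integrableOn_Icc).mono_set Ioc_subset_Icc_self
  · refine (ae_restrict_iff' measurableSet_Ioc).2 (Eventually.of_forall fun x hx => ?_)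
    have : 0 ≤ s - x := sub_nonneg.2 hx.2
    simp only [hf, Pi.zero_apply]
    positivity

/-- After `k` arrivals up to time `s`, exponential waiting times start afresh. -/
theorem infinitePi_residual {r : ℝ} (hr : 0 < r) [IsProbabilityMeasure (expMeasure r)]
    {F : Set (ℕ → ℝ)} (hF : MeasurableSet F) (k : ℕ) {s : ℝ} (hs : 0 ≤ s) :
    Measure.infinitePi (fun _ : ℕ => expMeasure r)
        {w | partialSum w k ≤ s ∧ s < partialSum w (k + 1) ∧ residual s k w ∈ F} =
      ENNReal.ofReal (poissonWeight (r * s) k) *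
        Measure.infinitePi (fun _ : ℕ => expMeasure r) F := by
  have hmeas : ∀ (k : ℕ) (s : ℝ), MeasurableSet
      {w | partialSum w k ≤ s ∧ s < partialSum w (k + 1) ∧ residual s k w ∈ F} := fun k s =>
    (measurableSet_le (measurable_partialSum _) measurable_const).inter
      ((measurableSet_lt measurable_const (measurable_partialSum _)).inter
        (measurable_residual _ _ hF))
  induction k generalizing s with
  | zero =>
    -- With no arrival up to `s` the first waiting time exceeds `s`, and by lack of memory its
    -- excess is again exponential.
    rw [infinitePi_apply_consSeq _ (hmeas 0 s), infinitePi_apply_consSeq _ hF]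
    have := lintegral_expMeasure_shift (r := r) hs (measurable_infinitePi_consSeq (expMeasure r) hF)
    simp only [poissonWeight, pow_zero, mul_one, Nat.factorial_zero, Nat.cast_one, div_one]
    rw [← this]
    refine lintegral_congr fun x => ?_
    by_cases hx : s < x
    · simp [hs, partialSum_consSeq, residual_consSeq_zero, hx]
    · simp [partialSum_consSeq, hx]
  | succ k ih =>
    rw [infinitePi_apply_consSeq _ (hmeas (k + 1) s), ← lintegral_expMeasure_poissonWeight hr hs,
      ← lintegral_mul_const']
    · refine lintegral_congr fun x => ?_
      have hset : {w | consSeq x w ∈ {w | partialSum w (k + 1) ≤ s ∧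
          s < partialSum w (k + 1 + 1) ∧ residual s (k + 1) w ∈ F}} =
          {w | partialSum w k ≤ s - x ∧ s - x < partialSum w (k + 1) ∧
            residual (s - x) k w ∈ F} := by
        ext w
        simp only [mem_ofPred_eq, partialSum_consSeq, residual_consSeq_succ]
        rw [le_sub_iff_add_le', sub_lt_iff_lt_add']
      rw [hset]
      -- A first arrival at `x ≤ s` leaves `k` arrivals for a horizon `s - x`, which is the
      -- induction hypothesis. If `x > s` the event is null, because partial sums of positive
      -- waiting times are not negative.
      by_cases hx : x ≤ s
      · rw [ih (sub_nonneg.2 hx)]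
        simp [hx]
      · rw [indicator_of_notMem (by simpa using hx), zero_mul]
        refine measure_mono_null (fun w hw => ?_) (ae_iff.1 (ae_infinitePi_pos hr))
        intro hpos
        have h0 : 0 ≤ partialSum w k := Finset.sum_nonneg fun i _ => (hpos i).le
        have := hw.1
        push Not at hx
        linarith
    · exact measure_ne_top _ _

theorem infinitePi_countEvent {r : ℝ} (hr : 0 < r) [IsProbabilityMeasure (expMeasure r)]
    (m : ℕ) (t : Fin (m + 1) → ℝ≥0) (ht : Monotone t) (k : Fin m → ℕ) :
    Measure.infinitePi (fun _ : ℕ => expMeasure r) (countEvent m t k) =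
      ∏ j, ENNReal.ofReal (poissonWeight (r * ((t j.succ : ℝ) - t j.castSucc)) (k j)) := by
  induction m with
  | zero => simp [countEvent]
  | succ m ih =>
    have h01 : t 0 ≤ t 1 := ht (Fin.zero_le 1)
    have htail : Monotone fun i : Fin (m + 1) => t i.succ :=
      fun a b hab => ht (Fin.succ_le_succ_iff.2 hab)
    have := infinitePi_residual hr
      (measurableSet_countEvent m (fun i => t i.succ) fun j => k j.succ) (k 0)
      (s := (t 1 : ℝ) - t 0) (sub_nonneg.2 (by exact_mod_cast h01))
    rw [Fin.prod_univ_succ]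
    change Measure.infinitePi (fun _ : ℕ => expMeasure r) {w | _ ∧ _ ∧ _} = _
    rw [this, ih _ htail]
    rfl

/-! ### Poisson increments from exponential waiting times -/

/-- Up to a null set, `E` is a union of cells `A i`. Used with the integer points as cells to
identify laws of increments, and with the count events as cells to identify laws of waiting times.
-/
theorem measure_eq_of_countable_partition {X ι : Type*} [MeasurableSpace X] [Countable ι]
    (μ ν : Measure X) [IsProbabilityMeasure μ] [IsProbabilityMeasure ν] (A : ι → Set X)
    (hA : ∀ i, MeasurableSet (A i)) (hd : Pairwise (Function.onFun Disjoint A))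
    (h : ∀ i, μ (A i) = ν (A i)) (h1 : ∑' i, ν (A i) = 1) {E : Set X} (hE : MeasurableSet E)
    (hdich : ∀ i, A i ⊆ E ∨ Disjoint (A i) E) : μ E = ν E := by
  have key : ∀ ρ : Measure X, IsProbabilityMeasure ρ → ρ (⋃ i, A i) = 1 →
      ρ E = ∑' i, ρ (A i ∩ E) := by
    intro ρ _ hρ
    have hU : MeasurableSet (⋃ i, A i) := MeasurableSet.iUnion hA
    have hnull : ρ (⋃ i, A i)ᶜ = 0 := (prob_compl_eq_zero_iff hU).2 hρ
    rw [← measure_iUnion (fun i j hij => ((hd hij).mono inter_subset_left inter_subset_left))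
      (fun i => (hA i).inter hE), ← iUnion_inter]
    refine (measure_eq_measure_of_null_sdiff inter_subset_right ?_).symm
    exact measure_mono_null (fun x hx hx' => hx.2 ⟨hx', hx.1⟩) hnull
  have hν : ν (⋃ i, A i) = 1 := by rw [measure_iUnion hd hA, h1]
  have hμ : μ (⋃ i, A i) = 1 := by
    rw [measure_iUnion hd hA]; simp_rw [h]; exact h1
  rw [key μ inferInstance hμ, key ν inferInstance hν]
  refine tsum_congr fun i => ?_
  rcases hdich i with hi | hi
  · rw [inter_eq_left.2 hi, h]
  · rw [hi.inter_eq, measure_empty, measure_empty]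

theorem poissonMeasure_singleton_eq (a : ℝ≥0) (k : ℕ) :
    poissonMeasure a {k} = ENNReal.ofReal (poissonWeight a k) :=
  poissonMeasure_singleton a k

theorem measurable_natCast_ereal : Measurable fun n : ℕ => (n : EReal) := measurable_from_nat

theorem natCast_ereal_injective : Function.Injective fun n : ℕ => (n : EReal) :=
  fun a b h => by
    have h' : (a : EReal) = (b : EReal) := h
    exact_mod_cast h'

instance isProbabilityMeasure_poissonLaw (a : ℝ≥0) : IsProbabilityMeasure (poissonLaw a) :=
  Measure.isProbabilityMeasure_map measurable_natCast_ereal.aemeasurable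

theorem poissonLaw_singleton (a : ℝ≥0) (k : ℕ) :
    poissonLaw a {(k : EReal)} = ENNReal.ofReal (poissonWeight a k) := by
  rw [poissonLaw, Measure.map_apply measurable_natCast_ereal (measurableSet_singleton _),
    ← poissonMeasure_singleton_eq]
  congr 1
  ext n
  simp

/-- The sum is the total mass of a product of Poisson laws on a countable space. -/
theorem tsum_prod_poissonWeight {m : ℕ} (a : Fin m → ℝ≥0) :
    ∑' k : Fin m → ℕ, ∏ j, ENNReal.ofReal (poissonWeight (a j) (k j)) = 1 := by
  have h := Measure.tsum_indicator_apply_singleton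
    (Measure.pi fun j => poissonMeasure (a j)) univ MeasurableSet.univ
  rw [measure_univ] at h
  rw [← h]
  refine tsum_congr fun k => ?_
  simp [Measure.pi_singleton, poissonMeasure_singleton_eq]

/-- A law on `EReal^m` with the atoms of a product of Poisson laws is this product. -/
theorem eq_pi_poissonLaw {m : ℕ} (a : Fin m → ℝ≥0) (μ : Measure (Fin m → EReal))
    [IsProbabilityMeasure μ]
    (h : ∀ k : Fin m → ℕ, μ {fun j => (k j : EReal)} =
      ∏ j, ENNReal.ofReal (poissonWeight (a j) (k j))) :
    μ = Measure.pi fun j => poissonLaw (a j) := by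
  have hν : ∀ k : Fin m → ℕ, (Measure.pi fun j => poissonLaw (a j)) {fun j => (k j : EReal)} =
      ∏ j, ENNReal.ofReal (poissonWeight (a j) (k j)) := fun k => by
    simp [Measure.pi_singleton, poissonLaw_singleton]
  refine Measure.ext fun E hE => ?_
  refine measure_eq_of_countable_partition μ _ (fun k : Fin m → ℕ => {fun j => (k j : EReal)})
    (fun k => measurableSet_singleton _) ?_ (fun k => by rw [h, hν]) ?_ hE fun k => ?_
  · intro k l hkl
    refine disjoint_singleton.2 fun heq => hkl ?_
    funext j
    exact natCast_ereal_injective (congrFun heq j)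
  · simp_rw [hν]; exact tsum_prod_poissonWeight a
  · by_cases hk : (fun j => (k j : EReal)) ∈ E
    · exact Or.inl (singleton_subset_iff.2 hk)
    · exact Or.inr (disjoint_singleton_left.2 hk)

section Renewal

variable {Ω : Type*} [MeasurableSpace Ω] {Q : Measure Ω} {N : ℝ≥0 → Ω → EReal} {r : ℝ}

theorem map_interarrivals (hN : IsCountingProcess N)
    [IsProbabilityMeasure (expMeasure r)]
    (hind : iIndepFun (interarrival N) Q) (hlaw : ∀ n, Q.map (interarrival N n) = expMeasure r) :
    Q.map (fun ω n => interarrival N n ω) = Measure.infinitePi fun _ : ℕ => expMeasure r := by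
  rw [hind.map_fun_eq_infinitePi_map hN.measurable_interarrival]
  simp_rw [hlaw]

theorem isTimeGrid_pair {t : ℝ≥0} (ht : 0 < t) : IsTimeGrid ![0, t] :=
  ⟨rfl, Fin.strictMono_iff_lt_succ.2 fun i => by fin_cases i; simpa using ht⟩

theorem IsCountingProcess.increment_pair (hN : IsCountingProcess N) (t : ℝ≥0) (ω : Ω) :
    increment N ![0, t] 0 ω = N t ω := by
  simp [increment, hN.zero]

variable [IsProbabilityMeasure Q]

theorem map_increments_of_grid (hN : IsCountingProcess N) (hr : 0 < r)
    (hind : iIndepFun (interarrival N) Q) (hlaw : ∀ n, Q.map (interarrival N n) = expMeasure r)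
    {m : ℕ} {t : Fin (m + 1) → ℝ≥0} (ht : IsTimeGrid t) :
    Q.map (fun ω j => increment N t j ω) =
      Measure.pi fun j => poissonLaw (r.toNNReal * (t j.succ - t j.castSucc)) := by
  have := isProbabilityMeasure_expMeasure hr
  have hm := hN.measurable_increments t
  have : IsProbabilityMeasure (Q.map fun ω j => increment N t j ω) :=
    Measure.isProbabilityMeasure_map hm.aemeasurable
  refine eq_pi_poissonLaw _ _ fun k => ?_
  rw [Measure.map_apply hm (measurableSet_singleton _)]
  have hset : (fun ω j => increment N t j ω) ⁻¹' {fun j => (k j : EReal)} =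
      ⋂ j, {ω | increment N t j ω = (k j : EReal)} := by
    ext ω; simp [funext_iff]
  rw [hset, hN.setOf_increment_eq ht, ← Measure.map_apply hN.measurable_interarrivals
    (measurableSet_countEvent _ _ _), map_interarrivals hN hind hlaw,
    infinitePi_countEvent hr m t ht.2.monotone]
  refine Finset.prod_congr rfl fun j _ => ?_
  have : t j.castSucc ≤ t j.succ := ht.2.monotone Fin.castSucc_lt_succ.le
  rw [NNReal.coe_mul, NNReal.coe_sub this, Real.coe_toNNReal _ hr.le]

theorem iIndepFun_increments_of_grid (hN : IsCountingProcess N) (hr : 0 < r)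
    (hind : iIndepFun (interarrival N) Q) (hlaw : ∀ n, Q.map (interarrival N n) = expMeasure r)
    {m : ℕ} {t : Fin (m + 1) → ℝ≥0} (ht : IsTimeGrid t) :
    iIndepFun (increment N t) Q ∧
      ∀ j, Q.map (increment N t j) = poissonLaw (r.toNNReal * (t j.succ - t j.castSucc)) := by
  have hjoint := map_increments_of_grid hN hr hind hlaw ht
  have hmarg : ∀ j, Q.map (increment N t j) =
      poissonLaw (r.toNNReal * (t j.succ - t j.castSucc)) := fun j => by
    rw [← (measurePreserving_eval (fun j => poissonLaw (r.toNNReal * (t j.succ - t j.castSucc)))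
      j).map_eq, ← hjoint, Measure.map_map (measurable_pi_apply j) (hN.measurable_increments t)]
    rfl
  refine ⟨?_, hmarg⟩
  rw [iIndepFun_iff_map_fun_eq_pi_map fun j => (hN.measurable_increment t j).aemeasurable, hjoint]
  simp_rw [hmarg]

/-- Stationarity involves shifted times, which do not start at `0`. Prepending the time `0` produces
a grid, and its first increment is then discarded. -/
theorem iIndepFun_increments (hN : IsCountingProcess N) (hr : 0 < r)
    (hind : iIndepFun (interarrival N) Q) (hlaw : ∀ n, Q.map (interarrival N n) = expMeasure r)
    {m : ℕ} {t : Fin (m + 1) → ℝ≥0} (ht : StrictMono t) :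
    iIndepFun (increment N t) Q ∧
      ∀ j, Q.map (increment N t j) = poissonLaw (r.toNNReal * (t j.succ - t j.castSucc)) := by
  rcases eq_or_ne (t 0) 0 with h0 | h0
  · exact iIndepFun_increments_of_grid hN hr hind hlaw ⟨h0, ht⟩
  · have hgrid : IsTimeGrid (Fin.cons 0 t : Fin (m + 1 + 1) → ℝ≥0) := by
      refine ⟨rfl, Fin.strictMono_iff_lt_succ.2 fun i => ?_⟩
      refine Fin.cases ?_ (fun i => ?_) i
      · simpa using pos_iff_ne_zero.2 h0
      · rw [← Fin.succ_castSucc]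
        simpa using ht Fin.castSucc_lt_succ
    obtain ⟨h1, h2⟩ := iIndepFun_increments_of_grid hN hr hind hlaw hgrid
    have hinc : ∀ j : Fin m, increment N (Fin.cons 0 t : Fin (m + 1 + 1) → ℝ≥0) j.succ =
        increment N t j := fun j => by
      funext ω
      simp [increment]
    refine ⟨?_, fun j => ?_⟩
    · have := h1.precomp (Fin.succ_injective m)
      simp only [hinc] at this
      exact this
    · rw [← hinc, h2]
      simp

theorem map_increments (hN : IsCountingProcess N) (hr : 0 < r)
    (hind : iIndepFun (interarrival N) Q) (hlaw : ∀ n, Q.map (interarrival N n) = expMeasure r)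
    {m : ℕ} {t : Fin (m + 1) → ℝ≥0} (ht : StrictMono t) :
    Q.map (fun ω j => increment N t j ω) =
      Measure.pi fun j => poissonLaw (r.toNNReal * (t j.succ - t j.castSucc)) := by
  obtain ⟨h1, h2⟩ := iIndepFun_increments hN hr hind hlaw ht
  rw [h1.map_fun_eq_pi_map fun j => (hN.measurable_increment t j).aemeasurable]
  simp_rw [h2]

/-- A renewal process with exponential interarrival times is a Poisson process. -/
theorem isPoissonProcess_of_exponential (hN : IsCountingProcess N) (hr : 0 < r)
    (hind : iIndepFun (interarrival N) Q)
    (hlaw : ∀ n, Q.map (interarrival N n) = expMeasure r) : IsPoissonProcess Q N r where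
  counting := hN
  pos := hr
  indep m t ht := (iIndepFun_increments hN hr hind hlaw ht.2).1
  stationary m t ht u := by
    have hshift : StrictMono fun i => t i + u := fun a b hab => by
      simpa using ht.2 hab
    refine ⟨(hN.measurable_increments _).aemeasurable,
      (hN.measurable_increments _).aemeasurable, ?_⟩
    rw [map_increments hN hr hind hlaw hshift, map_increments hN hr hind hlaw ht.2]
    simp only [add_tsub_add_eq_tsub_right]
  law t ht := by
    have h := (iIndepFun_increments hN hr hind hlaw (isTimeGrid_pair ht).2).2 0
    have h2 : increment N ![0, t] 0 = N t := funext (hN.increment_pair t)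
    rw [h2] at h
    simpa using h

end Renewal

/-! ### The law of the waiting times is determined by the counts -/

theorem measurableSet_setOf_forall_pos : MeasurableSet {w : ℕ → ℝ | ∀ n, 0 < w n} := by
  have : {w : ℕ → ℝ | ∀ n, 0 < w n} = ⋂ n, {w | 0 < w n} := by ext; simp
  rw [this]
  exact MeasurableSet.iInter fun n => measurableSet_lt measurable_const (measurable_pi_apply n)

theorem strictMono_partialSum {w : ℕ → ℝ} (hw : ∀ n, 0 < w n) : StrictMono (partialSum w) :=
  strictMono_nat_of_lt_succ fun n => by rw [partialSum_succ]; linarith [hw n]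

theorem residual_pos {w : ℕ → ℝ} (hw : ∀ n, 0 < w n) {s : ℝ} {k : ℕ}
    (hs : s < partialSum w (k + 1)) (n : ℕ) : 0 < residual s k w n := by
  cases n with
  | zero => exact sub_pos.2 hs
  | succ n => exact hw _

/-- Positive waiting times have strictly increasing partial sums, so the count in each interval is
determined. This makes the count events pairwise disjoint on positive sequences. -/
theorem countEvent_unique {m : ℕ} {t : Fin (m + 1) → ℝ≥0} {k l : Fin m → ℕ} {w : ℕ → ℝ}
    (hw : ∀ n, 0 < w n) (hk : w ∈ countEvent m t k) (hl : w ∈ countEvent m t l) : k = l := by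
  induction m generalizing w with
  | zero => exact Subsingleton.elim _ _
  | succ m ih =>
    have hmono := strictMono_partialSum hw
    have h1 : k 0 < l 0 + 1 := hmono.lt_iff_lt.1 (hk.1.trans_lt hl.2.1)
    have h2 : l 0 < k 0 + 1 := hmono.lt_iff_lt.1 (hl.1.trans_lt hk.2.1)
    have h0 : k 0 = l 0 := by omega
    have hk' := hk.2.2
    rw [h0] at hk'
    have := ih (residual_pos hw hl.2.1) hk' hl.2.2
    funext j
    refine Fin.cases h0 (fun j => ?_) j
    exact congrFun this j

/-- On the event described by the counts `k`, it is known which partial sums exceed which of the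
times `t j`. -/
theorem exists_partialSum_iff (m : ℕ) (t : Fin (m + 1) → ℝ≥0) (ht : Monotone t) (k : Fin m → ℕ) :
    ∃ c : Fin (m + 1) → ℕ, ∀ w ∈ countEvent m t k, (∀ n, 0 < w n) →
      ∀ j n, (t j : ℝ) - t 0 < partialSum w n ↔ c j < n := by
  have hzero : ∀ w : ℕ → ℝ, (∀ n, 0 < w n) → ∀ n, 0 < partialSum w n ↔ 0 < n := fun w hw n => by
    rw [← partialSum_zero w]; exact (strictMono_partialSum hw).lt_iff_lt
  induction m with
  | zero =>
    refine ⟨fun _ => 0, fun w _ hw j n => ?_⟩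
    rw [Fin.fin_one_eq_zero j, sub_self]
    exact hzero w hw n
  | succ m ih =>
    obtain ⟨c, hc⟩ := ih (fun i => t i.succ) (fun a b hab => ht (Fin.succ_le_succ_iff.2 hab))
      fun j => k j.succ
    -- `c j` is the total number of arrivals up to `t j`, counted from `t 0`.
    refine ⟨Fin.cons 0 fun j => k 0 + c j, fun w hwE hw j n => ?_⟩
    refine Fin.cases ?_ (fun j => ?_) j
    · rw [sub_self, Fin.cons_zero]
      exact hzero w hw n
    · rw [Fin.cons_succ]
      obtain ⟨h1, h2, h3⟩ := hwE
      have hres := hc _ h3 (residual_pos hw h2) j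
      have h1j : (t 1 : ℝ) ≤ t j.succ := by
        exact_mod_cast ht (Fin.succ_le_succ_iff.2 (Fin.zero_le j))
      rcases le_or_gt n (k 0) with hn | hn
      · have := (strictMono_partialSum hw).monotone hn
        refine iff_of_false (by linarith) (by omega)
      · obtain ⟨i, rfl⟩ := Nat.exists_eq_add_of_lt hn
        have hi := hres (i + 1)
        rw [partialSum_residual] at hi
        change (t j.succ : ℝ) - t 1 < _ ↔ _ at hi
        constructor
        · intro h
          have := hi.1 (by linarith)
          omega
        · intro h
          have := hi.2 (by omega)
          linarith

/-- Take all thresholds in `s`, together with `0`, as a time grid. On each count event of this grid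
the truth of every inequality `p.2 < partialSum w (p.1 + 1)` is constant, so the event is a union of
count events up to a null set. Hypothesis `h1` says that these exhaust the space. -/
theorem measure_setOf_partialSum_eq (μ ν : Measure (ℕ → ℝ)) [IsProbabilityMeasure μ]
    [IsProbabilityMeasure ν] (hμ : ∀ᵐ w ∂μ, ∀ n, 0 < w n) (hν : ∀ᵐ w ∂ν, ∀ n, 0 < w n)
    (h : ∀ (m : ℕ) (t : Fin (m + 1) → ℝ≥0), IsTimeGrid t → ∀ k : Fin m → ℕ,
      μ (countEvent m t k) = ν (countEvent m t k))
    (h1 : ∀ (m : ℕ) (t : Fin (m + 1) → ℝ≥0), IsTimeGrid t →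
      ∑' k : Fin m → ℕ, ν (countEvent m t k) = 1) (s : Finset (ℕ × ℝ)) :
    μ {w | ∀ p ∈ s, p.2 < partialSum w (p.1 + 1)} =
      ν {w | ∀ p ∈ s, p.2 < partialSum w (p.1 + 1)} := by
  classical
  set pos : Set (ℕ → ℝ) := {w | ∀ n, 0 < w n} with hpos
  have hposm : MeasurableSet pos := measurableSet_setOf_forall_pos
  have hinter : ∀ ρ : Measure (ℕ → ℝ), (∀ᵐ w ∂ρ, ∀ n, 0 < w n) → ∀ A, ρ (A ∩ pos) = ρ A :=
    fun ρ hρ A => measure_inter_conull hρ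
  have hEm : MeasurableSet {w | ∀ p ∈ s, p.2 < partialSum w (p.1 + 1)} := by
    have : {w | ∀ p ∈ s, p.2 < partialSum w (p.1 + 1)} =
        ⋂ p ∈ s, {w | p.2 < partialSum w (p.1 + 1)} := by ext; simp
    rw [this]
    exact Finset.measurableSet_biInter s fun p _ =>
      measurableSet_lt measurable_const (measurable_partialSum _)
  -- `toNNReal` sends negative thresholds to `0`; this is harmless, since those inequalities hold
  -- for every positive sequence.
  set F : Finset ℝ≥0 := insert 0 (s.image fun p => p.2.toNNReal) with hF
  obtain ⟨m, hm⟩ : ∃ m, F.card = m + 1 :=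
    Nat.exists_eq_succ_of_ne_zero (Finset.card_ne_zero_of_mem (Finset.mem_insert_self 0 _))
  set t : Fin (m + 1) → ℝ≥0 := fun i => F.orderEmbOfFin hm i with ht
  have hrange : ∀ x ∈ F, ∃ j, t j = x := fun x hx => by
    have : x ∈ Set.range (F.orderEmbOfFin hm) := by
      rw [Finset.range_orderEmbOfFin]; exact hx
    exact this
  have htm : StrictMono t := (F.orderEmbOfFin hm).strictMono
  have ht0 : t 0 = 0 := by
    obtain ⟨j, hj⟩ := hrange 0 (Finset.mem_insert_self 0 _)
    exact le_antisymm (hj ▸ htm.monotone (Fin.zero_le j)) zero_le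
  have hgrid : IsTimeGrid t := ⟨ht0, htm⟩
  rw [← hinter μ hμ, ← hinter ν hν]
  refine measure_eq_of_countable_partition μ ν (fun k : Fin m → ℕ => countEvent m t k ∩ pos)
    (fun k => (measurableSet_countEvent _ _ _).inter hposm) ?_ (fun k => ?_) ?_
    (hEm.inter hposm) fun k => ?_
  · intro k l hkl
    refine Set.disjoint_left.2 fun w hw hw' => hkl (countEvent_unique hw.2 hw.1 hw'.1)
  · rw [hinter μ hμ, hinter ν hν, h m t hgrid]
  · simp_rw [hinter ν hν]
    exact h1 m t hgrid
  · obtain ⟨c, hc⟩ := exists_partialSum_iff m t htm.monotone k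
    have key : ∀ p ∈ s, ∃ q : Prop, ∀ w ∈ countEvent m t k ∩ pos,
        p.2 < partialSum w (p.1 + 1) ↔ q := by
      intro p hp
      rcases lt_or_ge p.2 0 with hneg | hnn
      · refine ⟨True, fun w hw => iff_true_intro (hneg.trans_le ?_)⟩
        exact Finset.sum_nonneg fun i _ => (hw.2 i).le
      · obtain ⟨j, hj⟩ := hrange p.2.toNNReal
          (Finset.mem_insert_of_mem (Finset.mem_image_of_mem _ hp))
        refine ⟨c j < p.1 + 1, fun w hw => ?_⟩
        rw [← hc w hw.1 hw.2 j, hj, ht0, Real.coe_toNNReal _ hnn, NNReal.coe_zero, sub_zero]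
    by_cases hall : ∀ w ∈ countEvent m t k ∩ pos, ∀ p ∈ s, p.2 < partialSum w (p.1 + 1)
    · exact Or.inl fun w hw => ⟨hall w hw, hw.2⟩
    · push Not at hall
      obtain ⟨w, hw, p, hp, hwp⟩ := hall
      obtain ⟨q, hq⟩ := key p hp
      refine Or.inr (Set.disjoint_left.2 fun w' hw' hE => ?_)
      have hq' : q := (hq w' hw').1 (hE.1 p hp)
      exact absurd ((hq w hw).2 hq') (not_lt.2 hwp)

/-- Boxes are indexed by finite sets of pairs, in which a coordinate may occur repeatedly, so that
intersecting two boxes is just taking the union of the index sets. -/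
theorem measure_ext_of_Ioi_boxes (μ ν : Measure (ℕ → ℝ)) [IsProbabilityMeasure μ]
    [IsProbabilityMeasure ν]
    (h : ∀ s : Finset (ℕ × ℝ), μ {x | ∀ p ∈ s, p.2 < x p.1} = ν {x | ∀ p ∈ s, p.2 < x p.1}) :
    μ = ν := by
  classical
  set C : Set (Set (ℕ → ℝ)) := range fun s : Finset (ℕ × ℝ) => {x : ℕ → ℝ | ∀ p ∈ s, p.2 < x p.1}
    with hC
  refine ext_of_generate_finite C (le_antisymm ?_ ?_) ?_ ?_ (by simp)
  · refine iSup_le fun n => ?_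
    rw [← measurable_iff_comap_le]
    refine measurable_of_Ioi fun a => MeasurableSpace.measurableSet_generateFrom ⟨{(n, a)}, ?_⟩
    ext x; simp
  · refine MeasurableSpace.generateFrom_le ?_
    rintro _ ⟨s, rfl⟩
    have : {x : ℕ → ℝ | ∀ p ∈ s, p.2 < x p.1} = ⋂ p ∈ s, {x | p.2 < x p.1} := by ext; simp
    simp only [this]
    exact Finset.measurableSet_biInter s fun p _ =>
      measurableSet_lt measurable_const (measurable_pi_apply _)
  · rintro _ ⟨s, rfl⟩ _ ⟨s', rfl⟩ _
    refine ⟨s ∪ s', ?_⟩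
    ext x
    simp only [Finset.mem_union, mem_inter_iff, mem_ofPred_eq]
    exact ⟨fun h => ⟨fun p hp => h p (Or.inl hp), fun p hp => h p (Or.inr hp)⟩,
      fun h p hp => hp.elim (h.1 p) (h.2 p)⟩
  · rintro _ ⟨s, rfl⟩
    exact h s

/-- The law of a sequence of positive waiting times is determined by the joint laws of the
counts. -/
theorem measure_ext_of_countEvent (μ ν : Measure (ℕ → ℝ)) [IsProbabilityMeasure μ]
    [IsProbabilityMeasure ν] (hμ : ∀ᵐ w ∂μ, ∀ n, 0 < w n) (hν : ∀ᵐ w ∂ν, ∀ n, 0 < w n)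
    (h : ∀ (m : ℕ) (t : Fin (m + 1) → ℝ≥0), IsTimeGrid t → ∀ k : Fin m → ℕ,
      μ (countEvent m t k) = ν (countEvent m t k))
    (h1 : ∀ (m : ℕ) (t : Fin (m + 1) → ℝ≥0), IsTimeGrid t →
      ∑' k : Fin m → ℕ, ν (countEvent m t k) = 1) : μ = ν := by
  set S : (ℕ → ℝ) → ℕ → ℝ := fun w n => partialSum w (n + 1) with hS
  have hSm : Measurable S := measurable_pi_iff.2 fun n => measurable_partialSum (n + 1)
  -- Taking differences recovers the waiting times from the arrival times, so it suffices to
  -- identify the law of the latter.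
  set T : (ℕ → ℝ) → ℕ → ℝ := fun x n => n.casesOn (x 0) fun i => x (i + 1) - x i with hT
  have hTm : Measurable T := by
    refine measurable_pi_iff.2 fun n => ?_
    cases n with
    | zero => exact measurable_pi_apply 0
    | succ n => exact (measurable_pi_apply (n + 1)).sub (measurable_pi_apply n)
  have hTS : T ∘ S = id := by
    funext w n
    cases n with
    | zero => simp [hT, hS, partialSum]
    | succ n => simp [hT, hS, partialSum_succ w (n + 1)]
  have : IsProbabilityMeasure (μ.map S) := Measure.isProbabilityMeasure_map hSm.aemeasurable
  have : IsProbabilityMeasure (ν.map S) := Measure.isProbabilityMeasure_map hSm.aemeasurable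
  have hmap : μ.map S = ν.map S := by
    refine measure_ext_of_Ioi_boxes _ _ fun s => ?_
    have hm : MeasurableSet {x : ℕ → ℝ | ∀ p ∈ s, p.2 < x p.1} := by
      have : {x : ℕ → ℝ | ∀ p ∈ s, p.2 < x p.1} = ⋂ p ∈ s, {x | p.2 < x p.1} := by ext; simp
      rw [this]
      exact Finset.measurableSet_biInter s fun p _ =>
        measurableSet_lt measurable_const (measurable_pi_apply _)
    rw [Measure.map_apply hSm hm, Measure.map_apply hSm hm]
    exact measure_setOf_partialSum_eq μ ν hμ hν h h1 s
  have := congrArg (Measure.map T) hmap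
  rwa [Measure.map_map hTm hSm, Measure.map_map hTm hSm, hTS, Measure.map_id, Measure.map_id]
    at this

theorem measure_ext_of_Iic_rat {μ ν : Measure ℝ} [IsProbabilityMeasure μ] [IsProbabilityMeasure ν]
    (h : ∀ q : ℚ, μ (Iic (q : ℝ)) = ν (Iic (q : ℝ))) : μ = ν := by
  refine ext_of_generate_finite _
    ((BorelSpace.measurable_eq).trans Real.borel_eq_generateFrom_Iic_rat)
    Real.isPiSystem_Iic_rat ?_ (by simp)
  intro s hs
  obtain ⟨q, rfl⟩ : ∃ q : ℚ, Iic (q : ℝ) = s := by simpa using hs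
  exact h q

/-- The case `q = 0` excludes mass on `(-∞, 0]`, which settles the negative thresholds. -/
theorem eq_expMeasure_of_Ioi {ν : Measure ℝ} [IsProbabilityMeasure ν] {r : ℝ} (hr : 0 < r)
    (h : ∀ q : ℚ, 0 ≤ q → ν (Ioi (q : ℝ)) = ENNReal.ofReal (Real.exp (-(r * q)))) :
    ν = expMeasure r := by
  have := isProbabilityMeasure_expMeasure hr
  have key : ∀ q : ℚ, 0 ≤ q → ν (Iic (q : ℝ)) = expMeasure r (Iic (q : ℝ)) := fun q hq => by
    rw [← compl_Ioi, prob_compl_eq_one_sub measurableSet_Ioi,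
      prob_compl_eq_one_sub measurableSet_Ioi, h q hq, expMeasure_Ioi hr (by exact_mod_cast hq)]
  have hzero : expMeasure r (Iic ((0 : ℚ) : ℝ)) = 0 := by
    rw [← compl_Ioi, prob_compl_eq_one_sub measurableSet_Ioi, expMeasure_Ioi hr (by simp)]; simp
  refine measure_ext_of_Iic_rat fun q => ?_
  rcases le_or_gt 0 q with hq | hq
  · exact key q hq
  · have hsub : Iic (q : ℝ) ⊆ Iic ((0 : ℚ) : ℝ) := Iic_subset_Iic.2 (by exact_mod_cast hq.le)
    rw [measure_mono_null hsub ((key 0 le_rfl).trans hzero), measure_mono_null hsub hzero]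

/-- All exponential laws are rescalings of the standard one. `mixedExp` relies on this to mix
infinite product laws without a separate proof that they depend measurably on the parameter. -/
theorem map_div_expMeasure {y : ℝ} (hy : 0 < y) :
    (expMeasure 1).map (fun x => x / y) = expMeasure y := by
  have := isProbabilityMeasure_expMeasure one_pos
  have hm : Measurable fun x : ℝ => x / y := by fun_prop
  have : IsProbabilityMeasure ((expMeasure 1).map fun x => x / y) :=
    Measure.isProbabilityMeasure_map hm.aemeasurable
  refine eq_expMeasure_of_Ioi hy fun q hq => ?_
  have hs : (0 : ℝ) ≤ q := by exact_mod_cast hq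
  generalize (q : ℝ) = s at hs ⊢
  rw [Measure.map_apply hm measurableSet_Ioi]
  have : (fun x : ℝ => x / y) ⁻¹' Ioi s = Ioi (s * y) := by
    ext x; simp [lt_div_iff₀ hy]
  rw [this, expMeasure_Ioi one_pos (by positivity)]
  congr 3; ring

/-! ### Mixtures of exponential waiting times -/

/-- The law of a sequence of waiting times that is exponential with a random parameter of
law `U`. -/
def mixedExp (U : Measure ℝ) : Measure (ℕ → ℝ) :=
  haveI := isProbabilityMeasure_expMeasure one_pos
  (U.prod (Measure.infinitePi fun _ : ℕ => expMeasure 1)).map fun p i => p.2 i / p.1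

theorem measurable_scale : Measurable fun (p : ℝ × (ℕ → ℝ)) (i : ℕ) => p.2 i / p.1 :=
  measurable_pi_iff.2 fun i => ((measurable_pi_apply i).comp measurable_snd).div measurable_fst

instance isProbabilityMeasure_mixedExp (U : Measure ℝ) [IsProbabilityMeasure U] :
    IsProbabilityMeasure (mixedExp U) :=
  haveI := isProbabilityMeasure_expMeasure one_pos
  Measure.isProbabilityMeasure_map measurable_scale.aemeasurable

/-- Fubini, with the inner measure identified by rescaling. Only `y > 0` matters, and `f` need not
be assumed measurable. -/
theorem mixedExp_apply (U : Measure ℝ) [IsProbabilityMeasure U] (hU : ∀ᵐ y ∂U, 0 < y)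
    {F : Set (ℕ → ℝ)} (hF : MeasurableSet F) {f : ℝ → ℝ≥0∞}
    (hf : ∀ y, 0 < y → ∀ _ : IsProbabilityMeasure (expMeasure y),
      Measure.infinitePi (fun _ : ℕ => expMeasure y) F = f y) :
    mixedExp U F = ∫⁻ y, f y ∂U := by
  have := isProbabilityMeasure_expMeasure one_pos
  rw [mixedExp, Measure.map_apply measurable_scale hF, Measure.prod_apply (measurable_scale hF)]
  refine lintegral_congr_ae ?_
  filter_upwards [hU] with y hy
  have hpy := isProbabilityMeasure_expMeasure hy
  rw [← hf y hy hpy]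
  have hm : Measurable fun x : ℝ => x / y := by fun_prop
  have h := Measure.infinitePi_map_pi (fun _ : ℕ => expMeasure 1) (f := fun _ x => x / y)
    fun _ => hm
  simp only [map_div_expMeasure hy] at h
  have hm' : Measurable fun (x : ℕ → ℝ) i => x i / y :=
    measurable_pi_iff.2 fun i => hm.comp (measurable_pi_apply i)
  rw [← h, Measure.map_apply hm' hF]
  rfl

theorem mixedExp_pos (U : Measure ℝ) [IsProbabilityMeasure U] (hU : ∀ᵐ y ∂U, 0 < y) :
    ∀ᵐ w ∂mixedExp U, ∀ n, 0 < w n := by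
  have := mixedExp_apply U hU measurableSet_setOf_forall_pos.compl (f := fun _ => 0)
    fun y hy _ => ae_infinitePi_pos hy
  rwa [lintegral_zero] at this

theorem mixedExp_countEvent (U : Measure ℝ) [IsProbabilityMeasure U] (hU : ∀ᵐ y ∂U, 0 < y)
    {m : ℕ} {t : Fin (m + 1) → ℝ≥0} (ht : Monotone t) (k : Fin m → ℕ) :
    mixedExp U (countEvent m t k) =
      ∫⁻ y, ∏ j, ENNReal.ofReal (poissonWeight (y * ((t j.succ : ℝ) - t j.castSucc)) (k j)) ∂U :=
  mixedExp_apply U hU (measurableSet_countEvent _ _ _) fun _ hy _ =>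
    infinitePi_countEvent hy m t ht k

/-- Almost surely all counts are finite under the mixture; this is the exhaustion hypothesis of
`measure_ext_of_countEvent`. -/
theorem tsum_mixedExp_countEvent (U : Measure ℝ) [IsProbabilityMeasure U]
    (hU : ∀ᵐ y ∂U, 0 < y) {m : ℕ} {t : Fin (m + 1) → ℝ≥0} (ht : Monotone t) :
    ∑' k : Fin m → ℕ, mixedExp U (countEvent m t k) = 1 := by
  simp_rw [mixedExp_countEvent U hU ht]
  rw [← lintegral_tsum]
  · rw [lintegral_congr_ae (g := fun _ => 1), lintegral_one, measure_univ]
    filter_upwards [hU] with y hy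
    rw [← tsum_prod_poissonWeight fun j => y.toNNReal * (t j.succ - t j.castSucc)]
    refine tsum_congr fun k => Finset.prod_congr rfl fun j _ => ?_
    have : t j.castSucc ≤ t j.succ := ht Fin.castSucc_lt_succ.le
    rw [NNReal.coe_mul, NNReal.coe_sub this, Real.coe_toNNReal _ hy.le]
  · intro k
    refine (Finset.measurable_prod _ fun j _ => ?_).aemeasurable
    exact ((measurable_poissonWeight (k j)).comp (measurable_id.mul_const _)).ennreal_ofReal

theorem mixedExp_Ioi (U : Measure ℝ) [IsProbabilityMeasure U] (hU : ∀ᵐ y ∂U, 0 < y) (n : ℕ)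
    {a : ℕ → ℝ} (ha : ∀ i, 0 ≤ a i) :
    mixedExp U (Set.pi (Finset.range n) fun i => Ioi (a i)) =
      ∫⁻ y, ENNReal.ofReal (∏ i ∈ Finset.range n, Real.exp (-(y * a i))) ∂U := by
  refine mixedExp_apply U hU
    (MeasurableSet.pi (Finset.range n).countable_toSet fun i _ => measurableSet_Ioi) ?_
  intro y hy _
  rw [Measure.infinitePi_pi _ fun i _ => measurableSet_Ioi,
    ENNReal.ofReal_prod_of_nonneg fun i _ => (Real.exp_pos _).le]
  exact Finset.prod_congr rfl fun i _ => expMeasure_Ioi hy (ha i)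

section

variable {Ω : Type*} [MeasurableSpace Ω] {P : Measure Ω}
  {N : ℝ≥0 → Ω → EReal} {U : Measure ℝ}

theorem IsMPPDistribution.ae_pos (h : IsMPPDistribution P N U) : ∀ᵐ y ∂U, 0 < y :=
  haveI := h.prob
  (prob_compl_eq_zero_iff measurableSet_Ioi).2 h.pos

variable [IsProbabilityMeasure P]

/-- The interarrival times of a mixed Poisson process have a mixed exponential law. -/
theorem IsMPPDistribution.map_interarrivals (h : IsMPPDistribution P N U) :
    P.map (fun ω n => interarrival N n ω) = mixedExp U := by
  have := h.prob
  have hU := h.ae_pos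
  have hm := h.counting.measurable_interarrivals
  have : IsProbabilityMeasure (P.map fun ω n => interarrival N n ω) :=
    Measure.isProbabilityMeasure_map hm.aemeasurable
  refine measure_ext_of_countEvent _ _ ?_ (mixedExp_pos U hU) (fun m t ht k => ?_)
    fun m t ht => tsum_mixedExp_countEvent U hU ht.2.monotone
  · rw [ae_map_iff hm.aemeasurable measurableSet_setOf_forall_pos]
    exact Eventually.of_forall fun ω n => h.counting.interarrival_pos n ω
  · have hmix := h.mixture m t ht k
    rw [Measure.restrict_eq_self_of_ae_mem (s := Ioi 0) hU,
      integral_eq_lintegral_of_nonneg_ae] at hmix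
    · rw [Measure.map_apply hm (measurableSet_countEvent _ _ _),
        ← h.counting.setOf_increment_eq ht]
      have hfin : mixedExp U (countEvent m t k) ≠ ⊤ := measure_ne_top _ _
      refine (ENNReal.toReal_eq_toReal_iff' (measure_ne_top _ _) hfin).1 ?_
      rw [mixedExp_countEvent U hU ht.2.monotone]
      refine hmix.trans (congrArg _ (lintegral_congr_ae ?_))
      filter_upwards [hU] with y hy
      refine ENNReal.ofReal_prod_of_nonneg fun j _ => poissonWeight_nonneg ?_ _
      have : t j.castSucc ≤ t j.succ := ht.2.monotone Fin.castSucc_lt_succ.le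
      exact mul_nonneg hy.le (sub_nonneg.2 (by exact_mod_cast this))
    · filter_upwards [hU] with y hy
      refine Finset.prod_nonneg fun j _ => poissonWeight_nonneg ?_ _
      have : t j.castSucc ≤ t j.succ := ht.2.monotone Fin.castSucc_lt_succ.le
      exact mul_nonneg hy.le (sub_nonneg.2 (by exact_mod_cast this))
    · refine (Finset.measurable_prod _ fun j _ => ?_).aestronglyMeasurable
      exact (measurable_poissonWeight (k j)).comp (measurable_id.mul_const _)

theorem IsMPPDistribution.measure_interarrival_gt (h : IsMPPDistribution P N U) (n : ℕ)
    {a : ℕ → ℝ} (ha : ∀ i, 0 ≤ a i) :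
    P.real (⋂ i ∈ Finset.range n, {ω | a i < interarrival N i ω}) =
      ∫ y, ∏ i ∈ Finset.range n, Real.exp (-(y * a i)) ∂U := by
  have := h.prob
  have hms : MeasurableSet (Set.pi (Finset.range n : Set ℕ) fun i => Ioi (a i)) :=
    MeasurableSet.pi (Finset.range n).countable_toSet fun i _ => measurableSet_Ioi
  have hset : (⋂ i ∈ Finset.range n, {ω | a i < interarrival N i ω}) =
      (fun ω n => interarrival N n ω) ⁻¹' Set.pi (Finset.range n) fun i => Ioi (a i) := by
    ext ω; simp
  rw [hset, measureReal_def, ← Measure.map_apply h.counting.measurable_interarrivals hms,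
    h.map_interarrivals, mixedExp_Ioi U h.ae_pos n ha, ← integral_eq_lintegral_of_nonneg_ae]
  · exact Eventually.of_forall fun y => Finset.prod_nonneg fun i _ => (Real.exp_pos _).le
  · exact (by fun_prop : Measurable fun y => ∏ i ∈ Finset.range n,
      Real.exp (-(y * a i))).aestronglyMeasurable

end

/-! ### Recognizing exponential laws -/

theorem integrable_of_mem_Icc {X : Type*} [MeasurableSpace X] {μ : Measure X} [IsFiniteMeasure μ]
    {f : X → ℝ} (hf : AEStronglyMeasurable f μ) (h : ∀ᵐ x ∂μ, f x ∈ Icc (0 : ℝ) 1) :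
    Integrable f μ :=
  Integrable.of_bound hf 1 <| by
    filter_upwards [h] with x hx
    rw [Real.norm_of_nonneg hx.1]; exact hx.2

/-- Two triples of random variables with the same relevant moments: if `a' = b' c'` then also
`a = b c`. -/
theorem ae_eq_mul_of_integral_eq {X : Type*} [MeasurableSpace X] {μ : Measure X}
    [IsFiniteMeasure μ] {a b c a' b' c' : X → ℝ} (ha : Measurable a) (hb : Measurable b)
    (hc : Measurable c) (ha' : Measurable a') (hb' : Measurable b') (hc' : Measurable c')
    (hI : ∀ᵐ x ∂μ, a x ∈ Icc (0 : ℝ) 1 ∧ b x ∈ Icc (0 : ℝ) 1 ∧ c x ∈ Icc (0 : ℝ) 1)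
    (hI' : ∀ᵐ x ∂μ, a' x ∈ Icc (0 : ℝ) 1 ∧ b' x ∈ Icc (0 : ℝ) 1 ∧ c' x ∈ Icc (0 : ℝ) 1)
    (h1 : ∫ x, a x * a x ∂μ = ∫ x, a' x * a' x ∂μ)
    (h2 : ∫ x, a x * b x * c x ∂μ = ∫ x, a' x * b' x * c' x ∂μ)
    (h3 : ∫ x, b x * b x * c x * c x ∂μ = ∫ x, b' x * b' x * c' x * c' x ∂μ)
    (h' : ∀ x, a' x = b' x * c' x) : ∀ᵐ x ∂μ, a x = b x * c x := by
  -- The integral of `(a - b * c) ^ 2` depends only on three moments. They agree for the two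
  -- triples, and the integral vanishes for the primed one.
  have expand : ∀ {a b c : X → ℝ}, Measurable a → Measurable b → Measurable c →
      (∀ᵐ x ∂μ, a x ∈ Icc (0 : ℝ) 1 ∧ b x ∈ Icc (0 : ℝ) 1 ∧ c x ∈ Icc (0 : ℝ) 1) →
      Integrable (fun x => (a x - b x * c x) ^ 2) μ ∧
      ∫ x, (a x - b x * c x) ^ 2 ∂μ = ∫ x, a x * a x ∂μ - 2 * ∫ x, a x * b x * c x ∂μ +
        ∫ x, b x * b x * c x * c x ∂μ := by
    intro a b c ha hb hc hI
    have i1 : Integrable (fun x => a x * a x) μ :=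
      integrable_of_mem_Icc (ha.mul ha).aestronglyMeasurable <| by
        filter_upwards [hI] with x ⟨hx, _, _⟩
        exact ⟨mul_nonneg hx.1 hx.1, mul_le_one₀ hx.2 hx.1 hx.2⟩
    have i2 : Integrable (fun x => a x * b x * c x) μ :=
      integrable_of_mem_Icc ((ha.mul hb).mul hc).aestronglyMeasurable <| by
        filter_upwards [hI] with x ⟨hx, hy, hz⟩
        exact ⟨mul_nonneg (mul_nonneg hx.1 hy.1) hz.1,
          mul_le_one₀ (mul_le_one₀ hx.2 hy.1 hy.2) hz.1 hz.2⟩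
    have i3 : Integrable (fun x => b x * b x * c x * c x) μ :=
      integrable_of_mem_Icc (((hb.mul hb).mul hc).mul hc).aestronglyMeasurable <| by
        filter_upwards [hI] with x ⟨_, hy, hz⟩
        exact ⟨mul_nonneg (mul_nonneg (mul_nonneg hy.1 hy.1) hz.1) hz.1,
          mul_le_one₀ (mul_le_one₀ (mul_le_one₀ hy.2 hy.1 hy.2) hz.1 hz.2) hz.1 hz.2⟩
    have heq : (fun x => (a x - b x * c x) ^ 2) = fun x =>
        a x * a x - 2 * (a x * b x * c x) + b x * b x * c x * c x := by
      funext x; ring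
    have i4 : Integrable (fun x => 2 * (a x * b x * c x)) μ := i2.const_mul 2
    have i5 : Integrable (fun x => a x * a x - 2 * (a x * b x * c x)) μ := i1.sub i4
    rw [heq]
    refine ⟨i5.add i3, ?_⟩
    rw [integral_add i5 i3, integral_sub i1 i4, integral_const_mul]
  obtain ⟨hinteg, hval⟩ := expand ha hb hc hI
  have hval' := (expand ha' hb' hc' hI').2
  simp_rw [h', sub_self] at hval'
  simp_rw [h'] at h1 h2
  rw [h1, h2, h3, ← hval'] at hval
  simp only [ne_eq, OfNat.ofNat_ne_zero, not_false_eq_true, zero_pow, integral_zero] at hval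
  have := (integral_eq_zero_iff_of_nonneg (fun x => sq_nonneg _) hinteg).1 hval
  filter_upwards [this] with x hx
  have : (a x - b x * c x) ^ 2 = 0 := hx
  exact sub_eq_zero.1 (pow_eq_zero_iff two_ne_zero |>.1 this)

/-- Both sides are continuous in each variable on `(0, ∞)`, where the rationals are dense; the
identity is extended one variable at a time. -/
theorem mul_eq_of_rat {G : ℝ → ℝ} (hG : ContinuousOn G (Ioi 0))
    (hmul : ∀ s t : ℚ, 0 < s → 0 < t → G (s + t) = G s * G t) {s t : ℝ} (hs : 0 < s)
    (ht : 0 < t) : G (s + t) = G s * G t := by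
  have hdense : Ioi (0 : ℝ) ⊆ closure (Ioi (0 : ℝ) ∩ range ((↑) : ℚ → ℝ)) :=
    Rat.denseRange_cast.open_subset_closure_inter isOpen_Ioi
  have hadd : ∀ s : ℝ, 0 < s → ContinuousOn (fun t => G (s + t)) (Ioi 0) := fun s hs =>
    hG.comp (by fun_prop) fun t ht => add_pos hs ht
  have step : ∀ s : ℚ, 0 < s → ∀ t : ℝ, 0 < t → G (s + t) = G s * G t := by
    intro s hs
    have hs' : (0 : ℝ) < s := by exact_mod_cast hs
    refine EqOn.of_subset_closure (s := Ioi 0 ∩ range ((↑) : ℚ → ℝ)) ?_ (hadd s hs')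
      (continuousOn_const.mul hG) inter_subset_left hdense
    rintro _ ⟨ht, t, rfl⟩
    exact hmul s t hs (Rat.cast_pos.1 (mem_Ioi.1 ht))
  have step2 : EqOn (fun s => G (s + t)) (fun s => G s * G t) (Ioi 0) := by
    refine EqOn.of_subset_closure (s := Ioi 0 ∩ range ((↑) : ℚ → ℝ)) ?_ ?_
      (hG.mul continuousOn_const) inter_subset_left hdense
    · rintro _ ⟨hs, s, rfl⟩
      exact step s (Rat.cast_pos.1 (mem_Ioi.1 hs)) t ht
    · have := hadd t ht
      simpa only [add_comm] using this
  exact step2 hs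

/-- A multiplicative function on `(0, ∞)` that tends to `1` at `0` and whose derivative tends
to `-y` at `0` is `t ↦ exp (-y t)`. -/
theorem eq_exp_of_mul {G : ℝ → ℝ} {y : ℝ} (hG0 : Tendsto G (𝓝[>] 0) (𝓝 1))
    (hdiff : ∀ t, 0 < t → DifferentiableAt ℝ G t)
    (hderiv : Tendsto (deriv G) (𝓝[>] 0) (𝓝 (-y)))
    (hmul : ∀ s t : ℚ, 0 < s → 0 < t → G (s + t) = G s * G t) {t : ℝ} (ht : 0 < t) :
    G t = Real.exp (-(y * t)) := by
  have hcont : ContinuousOn G (Ioi 0) := fun t ht => (hdiff t ht).continuousAt.continuousWithinAt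
  have hmul' : ∀ s t : ℝ, 0 < s → 0 < t → G (s + t) = G s * G t := fun s t hs ht =>
    mul_eq_of_rat hcont hmul hs ht
  have hd1 : ∀ s t : ℝ, 0 < s → 0 < t → deriv G (s + t) = deriv G s * G t := by
    intro s t hs ht
    have h1 : (fun x => G (x + t)) =ᶠ[𝓝 s] fun x => G x * G t := by
      filter_upwards [lt_mem_nhds hs] with x hx using hmul' x t hx ht
    have := h1.deriv_eq
    rwa [deriv_comp_add_const, deriv_mul_const (hdiff s hs)] at this
  -- Differentiating `G (s + t) = G s * G t` in either variable gives the same value; letting `s ↓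
  -- 0` then yields `G' = -y * G`.
  have hsym : ∀ s t : ℝ, 0 < s → 0 < t → deriv G s * G t = deriv G t * G s := fun s t hs ht => by
    rw [← hd1 s t hs ht, ← hd1 t s ht hs, add_comm]
  have hode : ∀ t, 0 < t → deriv G t = -y * G t := fun t ht => by
    have l1 : Tendsto (fun s => deriv G s * G t) (𝓝[>] 0) (𝓝 (-y * G t)) :=
      hderiv.mul_const _
    have l2 : Tendsto (fun s => deriv G t * G s) (𝓝[>] 0) (𝓝 (deriv G t * 1)) :=
      hG0.const_mul _
    have heq : (fun s => deriv G s * G t) =ᶠ[𝓝[>] 0] fun s => deriv G t * G s := by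
      filter_upwards [self_mem_nhdsWithin] with s hs using hsym s t hs ht
    have := tendsto_nhds_unique l1 (l2.congr' heq.symm)
    rw [this, mul_one]
  -- `H` has zero derivative on `(0, ∞)`, and its constant value is its limit `1` at `0`.
  set H : ℝ → ℝ := fun t => G t * Real.exp (y * t) with hH
  have hHd : ∀ t, 0 < t → HasDerivAt H 0 t := fun t ht => by
    have h1 := (hdiff t ht).hasDerivAt
    have h2 : HasDerivAt (fun t => Real.exp (y * t)) (Real.exp (y * t) * y) t := by
      simpa using ((hasDerivAt_id t).const_mul y).exp
    have := h1.mul h2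
    rw [hode t ht] at this
    have h0 : -y * G t * Real.exp (y * t) + G t * (Real.exp (y * t) * y) = 0 := by ring
    rwa [h0] at this
  have hconst : ∀ s, 0 < s → H s = H t := fun s hs =>
    (convex_Ioi (0 : ℝ)).is_const_of_fderivWithin_eq_zero (𝕜 := ℝ)
      (fun x hx => (hHd x hx).differentiableAt.differentiableWithinAt)
      (fun x hx => by
        rw [fderivWithin_of_isOpen isOpen_Ioi hx]
        ext
        simp [(hHd x hx).deriv]) hs ht
  have l1 : Tendsto H (𝓝[>] 0) (𝓝 (1 * Real.exp (y * 0))) := by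
    refine hG0.mul ?_
    have : Continuous fun t => Real.exp (y * t) := by fun_prop
    exact (this.tendsto 0).mono_left nhdsWithin_le_nhds
  have l2 : Tendsto H (𝓝[>] 0) (𝓝 (H t)) :=
    tendsto_const_nhds.congr' (by
      filter_upwards [self_mem_nhdsWithin] with s hs using (hconst s hs).symm)
  have h1 := tendsto_nhds_unique l1 l2
  rw [mul_zero, Real.exp_zero, mul_one] at h1
  have : G t * Real.exp (y * t) = 1 := h1.symm
  rw [Real.exp_neg]
  exact eq_inv_of_mul_eq_one_left this

/-! ### Disintegrations and conditional probabilities -/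

/-- The families are measurable only as functions on the subtype `D`; extending them by zero gives
functions on `ℝ` to which change of variables and pointwise limits apply. -/
theorem measurable_indicator_of_subtype {β : Type*} [MeasurableSpace β] [Zero β] {D S : Set ℝ}
    (hS : MeasurableSet S) (hSD : S ⊆ D) {f : ℝ → β} (hf : Measurable fun θ : D => f θ) :
    Measurable (S.indicator f) := by
  refine measurable_of_restrict_of_restrict_compl hS ?_ ?_
  · have : S.domRestrict (S.indicator f) = (fun θ : D => f θ) ∘ Set.inclusion hSD := by
      funext θ
      simp [Set.domRestrict, θ.2]
    rw [this]
    exact hf.comp (measurable_inclusion hSD)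
  · have : Sᶜ.domRestrict (S.indicator f) = fun _ => 0 := by
      funext θ
      simp only [Set.domRestrict]
      exact indicator_of_notMem θ.2 f
    rw [this]
    exact measurable_const

section Disintegration

variable {Ω : Type*} [MeasurableSpace Ω] {P : Measure Ω} {Θ : Ω → ℝ} {D : Set ℝ}
  {R : ℝ → Measure Ω}

theorem IsDisintegration.measurable_comp {ν : Measure ℝ} (hR : IsDisintegration P ν D R)
    (hΘD : ∀ ω, Θ ω ∈ D) {A : Set Ω} (hA : MeasurableSet A) :
    Measurable[sigmaOf Θ] fun ω => R (Θ ω) A := by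
  have h1 : Measurable[sigmaOf Θ] fun ω => (⟨Θ ω, hΘD ω⟩ : D) :=
    Measurable.subtype_mk (comap_measurable Θ)
  exact (hR.measurable A hA).comp h1

theorem IsDisintegration.measurable_univ {ν : Measure ℝ} (hR : IsDisintegration P ν univ R)
    {A : Set Ω} (hA : MeasurableSet A) : Measurable fun y => R y A :=
  (hR.measurable A hA).comp (measurable_id.subtype_mk (h := fun y => mem_univ y))

theorem sigmaOf_le (hΘ : Measurable Θ) : sigmaOf Θ ≤ (inferInstance : MeasurableSpace Ω) :=
  hΘ.comap_le

theorem IsDisintegration.lintegral_comp (hR : IsDisintegration P (P.map Θ) D R)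
    (hΘ : Measurable Θ) (hD : MeasurableSet D) (hΘD : ∀ ω, Θ ω ∈ D) {A : Set Ω}
    (hA : MeasurableSet A) : ∫⁻ ω, R (Θ ω) A ∂P = P A := by
  have hm := measurable_indicator_of_subtype (f := fun θ => R θ A) hD Subset.rfl
    (hR.measurable A hA)
  rw [← hR.lintegral_eq A hA, ← lintegral_indicator hD, lintegral_map hm hΘ]
  exact lintegral_congr fun ω => by rw [indicator_of_mem (hΘD ω)]

theorem IsConsistentDisintegration.ae_consistent
    (hR : IsConsistentDisintegration P (P.map Θ) Θ D R) (hΘ : Measurable Θ)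
    (hΘD : ∀ ω, Θ ω ∈ D) {B : Set ℝ} (hB : MeasurableSet B) :
    ∀ᵐ ω ∂P, Θ ω ∈ B → R (Θ ω) (Θ ⁻¹' B) = 1 := by
  filter_upwards [ae_of_ae_map hΘ.aemeasurable (hR.consistent B hB)] with ω hω
  exact hω (hΘD ω)

/-- Consistency for `B` and for its complement gives `R θ (Θ ⁻¹' B ∩ A) = 1_B(θ) R θ A` for almost
every `θ`. This is the defining identity of conditional probability on `σ(Θ)`. -/
theorem IsConsistentDisintegration.measure_inter
    (hR : IsConsistentDisintegration P (P.map Θ) Θ D R) (hΘ : Measurable Θ)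
    (hD : MeasurableSet D) (hΘD : ∀ ω, Θ ω ∈ D) {A : Set Ω} (hA : MeasurableSet A) {B : Set ℝ}
    (hB : MeasurableSet B) : P (Θ ⁻¹' B ∩ A) = ∫⁻ ω in Θ ⁻¹' B, R (Θ ω) A ∂P := by
  rw [← hR.lintegral_comp hΘ hD hΘD ((hΘ hB).inter hA), ← lintegral_indicator (hΘ hB)]
  refine lintegral_congr_ae ?_
  filter_upwards [hR.ae_consistent hΘ hΘD hB, hR.ae_consistent hΘ hΘD hB.compl] with ω h1 h2
  have := hR.prob (Θ ω) (hΘD ω)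
  by_cases hω : Θ ω ∈ B
  · rw [indicator_of_mem (show ω ∈ Θ ⁻¹' B from hω), inter_comm]
    exact measure_inter_conull ((prob_compl_eq_zero_iff (hΘ hB)).2 (h1 hω))
  · rw [indicator_of_notMem (show ω ∉ Θ ⁻¹' B from hω)]
    refine measure_mono_null inter_subset_left ?_
    have := (prob_compl_eq_zero_iff (hΘ hB.compl)).2 (h2 hω)
    rwa [preimage_compl, compl_compl] at this

/-- A consistent disintegration gives the conditional probabilities. -/
theorem IsConsistentDisintegration.condProb_ae_eq [IsProbabilityMeasure P]
    (hR : IsConsistentDisintegration P (P.map Θ) Θ D R) (hΘ : Measurable Θ)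
    (hD : MeasurableSet D) (hΘD : ∀ ω, Θ ω ∈ D) {A : Set Ω} (hA : MeasurableSet A) :
    condProb P Θ A =ᵐ[P] fun ω => (R (Θ ω)).real A := by
  have hm : Measurable[sigmaOf Θ] fun ω => (R (Θ ω)).real A :=
    (hR.measurable_comp hΘD hA).ennreal_toReal
  have hm' : Measurable fun ω => (R (Θ ω)).real A := hm.mono (sigmaOf_le hΘ) le_rfl
  have hinteg : Integrable (fun ω => (R (Θ ω)).real A) P :=
    integrable_of_mem_Icc hm'.aestronglyMeasurable <| Eventually.of_forall fun ω => by
      have := hR.prob (Θ ω) (hΘD ω)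
      exact ⟨measureReal_nonneg, measureReal_le_one⟩
  refine (ae_eq_condExp_of_forall_setIntegral_eq (sigmaOf_le hΘ)
    ((integrable_const 1).indicator hA) (fun _ _ _ => hinteg.integrableOn) ?_
    hm.stronglyMeasurable.aestronglyMeasurable).symm
  rintro _ ⟨B, hB, rfl⟩ _
  change _ = ∫ x in Θ ⁻¹' B, A.indicator 1 x ∂P
  rw [integral_indicator_one hA, measureReal_restrict_apply hA, inter_comm, measureReal_def,
    hR.measure_inter hΘ hD hΘD hA hB, integral_eq_lintegral_of_nonneg_ae
      (Eventually.of_forall fun _ => measureReal_nonneg) hm'.aestronglyMeasurable]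
  congr 1
  refine lintegral_congr fun ω => ?_
  have := hR.prob (Θ ω) (hΘD ω)
  exact ENNReal.ofReal_toReal (measure_ne_top _ _)

end Disintegration

/-! ### Independence and identity of laws for almost every parameter -/

section Families

variable {Ω : Type*} [MeasurableSpace Ω]

/-- Reduces independence to countably many equations, so that it can be checked for almost every
parameter. The thresholds are indexed by the finite set `s`, since there are uncountably many maps
`ℕ → ℚ`. -/
theorem iIndepFun_of_Iic_rat {μ : Measure Ω} {X : ℕ → Ω → ℝ} (hX : ∀ n, Measurable (X n))
    (h : ∀ (s : Finset ℕ) (x : s → ℚ),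
      μ (⋂ i : s, {ω | X i ω ≤ x i}) = ∏ i : s, μ {ω | X i ω ≤ x i}) : iIndepFun X μ := by
  rw [iIndepFun_iff_iIndep]
  refine iIndepSets.iIndep (fun n => (hX n).comap_le)
    (fun n => {s | ∃ t ∈ ⋃ a : ℚ, {Iic (a : ℝ)}, X n ⁻¹' t = s})
    (fun n => Real.isPiSystem_Iic_rat.comap (X n)) (fun n => ?_) ?_
  · rw [BorelSpace.measurable_eq (α := ℝ), Real.borel_eq_generateFrom_Iic_rat,
      MeasurableSpace.comap_generateFrom]
    rfl
  · rw [iIndepSets_iff]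
    intro s f hf
    have hf' : ∀ i : s, ∃ q : ℚ, f i = {ω | X i ω ≤ q} := fun i => by
      obtain ⟨t, ht, hft⟩ := hf i i.2
      obtain ⟨q, rfl⟩ : ∃ q : ℚ, Iic (q : ℝ) = t := by simpa using ht
      exact ⟨q, hft.symm⟩
    choose x hx using hf'
    have := h s x
    simp_rw [← hx] at this
    rw [← Finset.prod_coe_sort, ← this]
    congr 1
    ext ω; simp

variable {P : Measure Ω} {Y : Type*} [MeasurableSpace Y] {Z : Ω → Y} {Q : Y → Measure Ω}

/-- The `σ`-algebra on the parameter space is left open: the lemma is applied to the Borel sets and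
to `familySigma Q`. -/
theorem ae_map_iIndepFun (hZ : Measurable Z) (hQ : ∀ A, MeasurableSet A → Measurable fun y => Q y A)
    {X : ℕ → Ω → ℝ} (hX : ∀ n, Measurable (X n))
    (h : ∀ (s : Finset ℕ) (x : s → ℚ), ∀ᵐ ω ∂P,
      Q (Z ω) (⋂ i : s, {ω | X i ω ≤ x i}) = ∏ i : s, Q (Z ω) {ω | X i ω ≤ x i}) :
    ∀ᵐ y ∂P.map Z, iIndepFun X (Q y) := by
  have hall : ∀ᵐ y ∂P.map Z, ∀ (s : Finset ℕ) (x : s → ℚ),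
      Q y (⋂ i : s, {ω | X i ω ≤ x i}) = ∏ i : s, Q y {ω | X i ω ≤ x i} := by
    refine ae_all_iff.2 fun s => ae_all_iff.2 fun x => ?_
    have hm : ∀ i : s, MeasurableSet {ω | X i ω ≤ x i} := fun i =>
      measurableSet_le (hX i) measurable_const
    rw [ae_map_iff hZ.aemeasurable]
    · exact h s x
    · exact measurableSet_eq_fun (hQ _ (MeasurableSet.iInter hm))
        (Finset.measurable_prod _ fun i _ => hQ _ (hm i))
  filter_upwards [hall] with y hy using iIndepFun_of_Iic_rat hX hy

theorem ae_map_map_eq (hZ : Measurable Z) (hQ : ∀ A, MeasurableSet A → Measurable fun y => Q y A)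
    (hprob : ∀ y, IsProbabilityMeasure (Q y)) {X X' : Ω → ℝ} (hX : Measurable X)
    (hX' : Measurable X')
    (h : ∀ q : ℚ, ∀ᵐ ω ∂P, Q (Z ω) {ω | X ω ≤ q} = Q (Z ω) {ω | X' ω ≤ q}) :
    ∀ᵐ y ∂P.map Z, (Q y).map X = (Q y).map X' := by
  have hall : ∀ᵐ y ∂P.map Z, ∀ q : ℚ, Q y {ω | X ω ≤ q} = Q y {ω | X' ω ≤ q} := by
    refine ae_all_iff.2 fun q => ?_
    rw [ae_map_iff hZ.aemeasurable]
    · exact h q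
    · exact measurableSet_eq_fun (hQ _ (measurableSet_le hX measurable_const))
        (hQ _ (measurableSet_le hX' measurable_const))
  filter_upwards [hall] with y hy
  have := hprob y
  have := Measure.isProbabilityMeasure_map (μ := Q y) hX.aemeasurable
  have := Measure.isProbabilityMeasure_map (μ := Q y) hX'.aemeasurable
  refine measure_ext_of_Iic_rat fun q => ?_
  rw [Measure.map_apply hX measurableSet_Iic, Measure.map_apply hX' measurableSet_Iic]
  exact hy q

end Families

/-! ### The transported disintegration -/

section Transport

variable {Ω : Type*} [MeasurableSpace Ω] {P : Measure Ω} {N : ℝ≥0 → Ω → EReal} {Θ : Ω → ℝ}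
  {D : Set ℝ} {R : ℝ → Measure Ω} {S : Set ℝ}

/-- The distribution functions are measurable in `θ`, their derivatives are limits of difference
quotients along `1 / (n + 1)`, and the initial density is the limit of the derivatives along the
same sequence. Cutting off outside `S` makes these limits exist at every `θ`. -/
theorem measurable_indicator_initialDensity (hN : IsCountingProcess N) {ν : Measure ℝ}
    (hR : IsDisintegration P ν D R) (hS : MeasurableSet S) (hSD : S ⊆ D)
    (hdiff : ∀ θ ∈ S, ∀ t, 0 < t → DifferentiableAt ℝ (interarrivalCDF N R θ) t)
    (hlim : ∀ θ ∈ S, Tendsto (deriv (interarrivalCDF N R θ)) (𝓝[>] 0)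
      (𝓝 (initialDensity N R θ))) :
    Measurable (S.indicator (initialDensity N R)) := by
  have hcdf : ∀ t, Measurable (S.indicator fun θ => interarrivalCDF N R θ t) := fun t =>
    measurable_indicator_of_subtype hS hSD
      (hR.measurable _ (measurableSet_le (hN.measurable_interarrival 0)
        measurable_const)).ennreal_toReal
  have hseq : Tendsto (fun n : ℕ => 1 / ((n : ℝ) + 1)) atTop (𝓝[>] 0) :=
    tendsto_nhdsWithin_iff.2 ⟨tendsto_one_div_add_atTop_nhds_zero_nat,
      Eventually.of_forall fun n => mem_Ioi.2 Nat.one_div_pos_of_nat⟩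
  have hderiv : ∀ t, 0 < t →
      Measurable (S.indicator fun θ => deriv (interarrivalCDF N R θ) t) := fun t ht => by
    refine measurable_of_tendsto_metrizable (f := fun n : ℕ => fun θ =>
      (1 / ((n : ℝ) + 1))⁻¹ •
        (S.indicator (fun θ => interarrivalCDF N R θ (t + 1 / ((n : ℝ) + 1))) θ -
          S.indicator (fun θ => interarrivalCDF N R θ t) θ))
      (fun n => ((hcdf (t + 1 / ((n : ℝ) + 1))).sub (hcdf t)).const_smul ((1 / ((n : ℝ) + 1))⁻¹))
      (tendsto_pi_nhds.2 fun θ => ?_)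
    by_cases hθ : θ ∈ S
    · simp only [indicator_of_mem hθ]
      have := hasDerivAt_iff_tendsto_slope_zero.1 (hdiff θ hθ t ht).hasDerivAt
      exact this.comp (hseq.mono_right (nhdsWithin_mono 0 fun x hx => (mem_Ioi.1 hx).ne'))
    · simp [indicator_of_notMem hθ]
  refine measurable_of_tendsto_metrizable (f := fun n : ℕ =>
    S.indicator fun θ => deriv (interarrivalCDF N R θ) (1 / ((n : ℝ) + 1)))
    (fun n => hderiv _ Nat.one_div_pos_of_nat) (tendsto_pi_nhds.2 fun θ => ?_)
  by_cases hθ : θ ∈ S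
  · simp only [indicator_of_mem hθ]
    exact (hlim θ hθ).comp hseq
  · simp [indicator_of_notMem hθ]

theorem transport_apply {p : ℝ → ℝ} (hinj : InjOn p S) {θ : ℝ} (hθ : θ ∈ S) :
    transport P R p S (p θ) = R θ := by
  rw [transport, if_pos (mem_image_of_mem p hθ), hinj.leftInvOn_invFunOn hθ]

theorem transport_apply_of_notMem {p : ℝ → ℝ} {y : ℝ} (hy : y ∉ p '' S) :
    transport P R p S y = P :=
  if_neg hy

/-- An injective Borel map sends Borel sets to Borel sets (Lusin and Souslin). -/
theorem measurableSet_image_of_indicator {p : ℝ → ℝ} (hp : Measurable (S.indicator p))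
    (hinj : InjOn p S) {A : Set ℝ} (hA : MeasurableSet A) (hAS : A ⊆ S) :
    MeasurableSet (p '' A) := by
  have heq : EqOn (S.indicator p) p A := fun θ hθ => indicator_of_mem (hAS hθ) p
  rw [← heq.image_eq]
  exact hA.image_of_measurable_injOn hp ((hinj.mono hAS).congr heq.symm)

/-- By injectivity the preimage of `B` is the image under `p` of `{θ ∈ S | R θ A ∈ B}`, together
with the complement of `p '' S` when `P A ∈ B`. -/
theorem measurable_transport {ν : Measure ℝ} (hR : IsDisintegration P ν D R)
    (hS : MeasurableSet S) (hSD : S ⊆ D) {p : ℝ → ℝ} (hp : Measurable (S.indicator p))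
    (hinj : InjOn p S) {A : Set Ω} (hA : MeasurableSet A) :
    Measurable fun y => transport P R p S y A := by
  classical
  intro B hB
  have hRm := measurable_indicator_of_subtype (f := fun θ => R θ A) hS hSD
    (hR.measurable A hA)
  have hT : MeasurableSet (S ∩ (S.indicator fun θ => R θ A) ⁻¹' B) := hS.inter (hRm hB)
  have himS := measurableSet_image_of_indicator hp hinj hS Subset.rfl
  have himT := measurableSet_image_of_indicator hp hinj hT inter_subset_left
  have hset : (fun y => transport P R p S y A) ⁻¹' B =
      p '' (S ∩ (S.indicator fun θ => R θ A) ⁻¹' B) ∪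
        ((p '' S)ᶜ ∩ {_y : ℝ | P A ∈ B}) := by
    ext y
    by_cases hy : y ∈ p '' S
    · obtain ⟨θ, hθ, rfl⟩ := hy
      have h1 : p θ ∈ p '' (S ∩ (S.indicator fun θ => R θ A) ⁻¹' B) ↔ R θ A ∈ B := by
        constructor
        · rintro ⟨θ', ⟨hθ', hB'⟩, heq⟩
          rw [hinj hθ' hθ heq] at hB'
          simpa [hθ] using hB'
        · exact fun h => ⟨θ, ⟨hθ, by simpa [hθ] using h⟩, rfl⟩
      rw [mem_union, h1, mem_preimage, transport_apply hinj hθ]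
      simp [mem_image_of_mem p hθ]
    · have h1 : y ∉ p '' (S ∩ (S.indicator fun θ => R θ A) ⁻¹' B) := fun h =>
        hy (image_mono inter_subset_left h)
      rw [mem_union, mem_preimage, transport_apply_of_notMem hy]
      simp only [h1, false_or]
      exact ⟨fun h => ⟨hy, h⟩, fun h => h.2⟩
  rw [hset]
  exact himT.union (himS.compl.inter (MeasurableSet.const _))

/-- The transported family is a disintegration consistent with the transported parameter. -/
theorem isConsistentDisintegration_transport [IsProbabilityMeasure P]
    (hR : IsConsistentDisintegration P (P.map Θ) Θ D R) (hΘ : Measurable Θ)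
    (hD : MeasurableSet D) (hΘD : ∀ ω, Θ ω ∈ D) (hS : MeasurableSet S) (hSD : S ⊆ D)
    (hSae : ∀ᵐ ω ∂P, Θ ω ∈ S) {p : ℝ → ℝ} (hp : Measurable (S.indicator p))
    (hinj : InjOn p S) {Z : Ω → ℝ} (hZ : Measurable Z) (hZp : ∀ ω, Θ ω ∈ S → Z ω = p (Θ ω)) :
    IsConsistentDisintegration P (P.map Z) Z univ (transport P R p S) := by
  have hmeas := fun {A : Set Ω} (hA : MeasurableSet A) =>
    measurable_transport hR.toIsDisintegration hS hSD hp hinj hA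
  have hae : ∀ᵐ ω ∂P, transport P R p S (Z ω) = R (Θ ω) := by
    filter_upwards [hSae] with ω hω
    rw [hZp ω hω, transport_apply hinj hω]
  have hprob : ∀ y, IsProbabilityMeasure (transport P R p S y) := fun y => by
    by_cases hy : y ∈ p '' S
    · obtain ⟨θ, hθ, rfl⟩ := hy
      rw [transport_apply hinj hθ]
      exact hR.prob θ (hSD hθ)
    · rw [transport_apply_of_notMem hy]
      infer_instance
  refine ⟨⟨fun y _ => hprob y, fun A hA => (hmeas hA).comp measurable_subtype_coe,
    fun A hA => ?_⟩, rfl, fun B hB => ?_⟩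
  · rw [Measure.restrict_univ, lintegral_map (hmeas hA) hZ,
      ← hR.lintegral_comp hΘ hD hΘD hA]
    refine lintegral_congr_ae ?_
    filter_upwards [hae] with ω hω
    rw [hω]
  · have hms : MeasurableSet {y | y ∈ univ → y ∈ B → transport P R p S y (Z ⁻¹' B) = 1} := by
      have : {y | y ∈ univ → y ∈ B → transport P R p S y (Z ⁻¹' B) = 1} =
          Bᶜ ∪ {y | transport P R p S y (Z ⁻¹' B) = 1} := by
        ext y; simp [imp_iff_not_or]
      rw [this]
      exact hB.compl.union (measurableSet_eq_fun (hmeas (hZ hB)) measurable_const)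
    rw [ae_map_iff hZ.aemeasurable hms]
    -- On `{Θ ∈ S}` the condition `Z ∈ B` is a condition on `Θ`, so consistency of `R` for this set
    -- gives consistency of the transported family for `B`.
    have hB' : MeasurableSet (S ∩ S.indicator p ⁻¹' B) := hS.inter (hp hB)
    filter_upwards [hae, hSae, hR.ae_consistent hΘ hΘD hB'] with ω h1 h2 h3 _ hω
    rw [h1]
    have := hR.prob (Θ ω) (hΘD ω)
    refine le_antisymm prob_le_one ?_
    rw [← h3 ⟨h2, by rw [mem_preimage, indicator_of_mem h2, ← hZp ω h2]; exact hω⟩]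
    refine measure_mono fun ω' hω' => ?_
    have h5 : S.indicator p (Θ ω') ∈ B := hω'.2
    rw [indicator_of_mem hω'.1, ← hZp ω' hω'.1] at h5
    exact h5

/-- For an extended mixed renewal process the interarrival times are independent and identically
distributed under almost every measure of the transported disintegration. -/
theorem IsEMRP.ae_iid [IsProbabilityMeasure P] {h : ℝ → ℝ} {K : ℝ → Measure ℝ}
    (hN : IsEMRP P N Θ D h K)
    (hR : IsConsistentDisintegration P (P.map Θ) Θ D R) (hΘ : Measurable Θ)
    {Q : ℝ → Measure Ω} {Z : Ω → ℝ} (hZ : Measurable Z)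
    (hQ : IsConsistentDisintegration P (P.map Z) Z univ Q)
    (hae : ∀ᵐ ω ∂P, Q (Z ω) = R (Θ ω)) :
    ∀ᵐ y ∂P.map Z, iIndepFun (interarrival N) (Q y) ∧
      ∀ n, (Q y).map (interarrival N n) = (Q y).map (interarrival N 0) := by
  have hprob : ∀ y, IsProbabilityMeasure (Q y) := fun y => hQ.prob y (mem_univ y)
  have hmeas : ∀ A, MeasurableSet A → Measurable fun y => Q y A := fun A hA =>
    hQ.measurable_univ hA
  have hW := hN.counting.measurable_interarrival
  have hcond : ∀ A, MeasurableSet A → condProb P Θ A =ᵐ[P] fun ω => (Q (Z ω)).real A :=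
    fun A hA => by
      filter_upwards [hR.condProb_ae_eq hΘ hN.measurableSet hN.range_subset hA, hae] with ω h1 h2
      rw [h1, h2]
  refine (ae_map_iIndepFun hZ hmeas hW fun s x => ?_).and
    (ae_all_iff.2 fun n => ae_map_map_eq hZ hmeas hprob (hW n) (hW 0) fun q => ?_)
  · classical
    -- The default threshold `0` lies outside `s` and is never used.
    have h1 := hN.cond_indep s fun i => if hi : i ∈ s then (x ⟨i, hi⟩ : ℝ) else 0
    have hm : ∀ i : ℕ, MeasurableSet {ω | interarrival N i ω ≤
        if hi : i ∈ s then (x ⟨i, hi⟩ : ℝ) else 0} := fun i =>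
      measurableSet_le (hW i) measurable_const
    have hset : (⋂ i ∈ s, {ω | interarrival N i ω ≤
        if hi : i ∈ s then (x ⟨i, hi⟩ : ℝ) else 0}) =
        ⋂ i : s, {ω | interarrival N i ω ≤ x i} := by
      ext ω
      simp only [mem_iInter, mem_ofPred_eq, Subtype.forall]
      exact forall_congr' fun i => forall_congr' fun hi => by simp [hi]
    have h2 := hcond _ (Finset.measurableSet_biInter s fun i _ => hm i)
    have h3 : ∀ᵐ ω ∂P, ∀ i, condProb P Θ {ω | interarrival N i ω ≤
        if hi : i ∈ s then (x ⟨i, hi⟩ : ℝ) else 0} ω = (Q (Z ω)).real {ω | interarrival N i ω ≤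
        if hi : i ∈ s then (x ⟨i, hi⟩ : ℝ) else 0} := ae_all_iff.2 fun i => hcond _ (hm i)
    filter_upwards [h1, h2, h3] with ω e1 e2 e3
    rw [e2, hset] at e1
    simp_rw [e3] at e1
    rw [← Finset.prod_coe_sort] at e1
    simp only [Finset.coe_mem, dite_true] at e1
    refine (ENNReal.toReal_eq_toReal_iff' (measure_ne_top _ _)
      (ENNReal.prod_ne_top fun i _ => measure_ne_top _ _)).1 ?_
    rw [ENNReal.toReal_prod]
    exact e1
  -- The conditional law `K (h (Θ ω))` does not involve `n`; comparing `n` with `0` through it gives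
  -- identical laws.
  · have key : ∀ n, ∀ᵐ ω ∂P,
        (Q (Z ω)).real {ω | interarrival N n ω ≤ q} = (K (h (Θ ω))).real (Iic (q : ℝ)) := by
      intro n
      obtain ⟨κ, hκ, T, -, hT0, hT⟩ := hN.cond_law n
      have hTae : ∀ᵐ ω ∂P, ω ∉ T := measure_eq_zero_iff_ae_notMem.1 hT0
      filter_upwards [hκ.ae_eq (Iic (q : ℝ)) measurableSet_Iic,
        hcond _ (hW n (measurableSet_Iic (a := (q : ℝ)))), hTae] with ω e1 e2 e3
      have e4 : κ ω = K (h (Θ ω)) := hT ω e3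
      rw [← e4, e1, e2]
      rfl
    filter_upwards [key n, key 0] with ω e1 e2
    refine (ENNReal.toReal_eq_toReal_iff' (measure_ne_top _ _) (measure_ne_top _ _)).1 ?_
    exact e1.trans e2.symm

end Transport

/-! ### Mixtures of products of Poisson laws -/

theorem measurable_poissonLaw_apply (c : ℝ≥0) {B : Set EReal} (hB : MeasurableSet B) :
    Measurable fun y : ℝ => poissonLaw (y.toNNReal * c) B := by
  classical
  have h : ∀ y : ℝ, poissonLaw (y.toNNReal * c) B = ∑' n : ℕ,
      ((fun n : ℕ => (n : EReal)) ⁻¹' B).indicator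
        (fun n => ENNReal.ofReal (poissonWeight ((y.toNNReal * c : ℝ≥0) : ℝ) n)) n := fun y => by
    rw [poissonLaw, Measure.map_apply measurable_natCast_ereal hB,
      ← Measure.tsum_indicator_apply_singleton _ _ (measurable_natCast_ereal hB)]
    simp_rw [poissonMeasure_singleton_eq]
  simp_rw [h]
  refine Measurable.tsum fun n => ?_
  by_cases hn : n ∈ (fun n : ℕ => (n : EReal)) ⁻¹' B
  · simp only [indicator_of_mem hn]
    refine ((measurable_poissonWeight n).comp ?_).ennreal_ofReal
    exact (measurable_real_toNNReal.mul_const c).coe_nnreal_real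
  · simp only [indicator_of_notMem hn]
    exact measurable_const

/-- The boxes `∏ [-∞, a j]`. -/
def lowerBoxes (m : ℕ) : Set (Set (Fin m → EReal)) := 
  range fun a : Fin m → EReal => Set.pi univ fun j => Iic (a j)

theorem isPiSystem_lowerBoxes (m : ℕ) : IsPiSystem (lowerBoxes m) := by
  rintro _ ⟨a, rfl⟩ _ ⟨b, rfl⟩ _
  refine ⟨a ⊓ b, ?_⟩
  rw [← Set.pi_inter_distrib]
  simp [Iic_inter_Iic]

theorem generateFrom_lowerBoxes (m : ℕ) :
    (inferInstance : MeasurableSpace (Fin m → EReal)) =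
      MeasurableSpace.generateFrom (lowerBoxes m) := by
  classical
  refine le_antisymm ?_ ?_
  · refine iSup_le fun j => ?_
    rw [← measurable_iff_comap_le]
    -- As `⊤` is an admissible bound, a half-space in one coordinate is itself a lower box.
    refine measurable_of_Iic fun b => MeasurableSpace.measurableSet_generateFrom
      ⟨fun i => if i = j then b else ⊤, ?_⟩
    ext x
    simp only [Set.mem_pi, mem_univ, true_imp_iff, mem_Iic, mem_preimage]
    refine ⟨fun h => by simpa using h j, fun h i => ?_⟩
    split_ifs with hi
    · rw [hi]; exact h
    · exact le_top
  · refine MeasurableSpace.generateFrom_le ?_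
    rintro _ ⟨a, rfl⟩
    exact MeasurableSet.univ_pi fun j => measurableSet_Iic

theorem measurable_pi_poissonLaw {m : ℕ} (c : Fin m → ℝ≥0) :
    Measurable fun y : ℝ => Measure.pi fun j => poissonLaw (y.toNNReal * c j) := by
  refine Measurable.measure_of_isPiSystem_of_isProbabilityMeasure (generateFrom_lowerBoxes m)
    (isPiSystem_lowerBoxes m) ?_
  rintro _ ⟨a, rfl⟩
  simp only [Measure.pi_pi]
  exact Finset.measurable_prod _ fun j _ => measurable_poissonLaw_apply (c j) measurableSet_Iic

/-! ### Conditionally Poisson increments, mixtures of Poisson laws and disintegrations. -/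

section Equivalences

variable {Ω : Type*} [MeasurableSpace Ω] {P : Measure Ω} [IsProbabilityMeasure P]
  {N : ℝ≥0 → Ω → EReal} {Z : Ω → ℝ} {Q : ℝ → Measure Ω}

theorem condProb_ae_eq_of_forall_inter (hZ : Measurable Z) {A A' : Set Ω} (hA : MeasurableSet A)
    (hA' : MeasurableSet A')
    (h : ∀ F, MeasurableSet[sigmaOf Z] F → P (F ∩ A) = P (F ∩ A')) :
    condProb P Z A =ᵐ[P] condProb P Z A' := by
  have hle := sigmaOf_le hZ
  have hi : ∀ {A : Set Ω}, MeasurableSet A → Integrable (A.indicator fun _ => (1 : ℝ)) P :=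
    fun hA => (integrable_const 1).indicator hA
  refine ae_eq_condExp_of_forall_setIntegral_eq hle (hi hA')
    (fun _ _ _ => integrable_condExp.integrableOn) (fun F hF _ => ?_)
    stronglyMeasurable_condExp.aestronglyMeasurable
  rw [condProb, setIntegral_condExp hle (hi hA) hF]
  change ∫ x in F, A.indicator 1 x ∂P = ∫ x in F, A'.indicator 1 x ∂P
  rw [integral_indicator_one hA, integral_indicator_one hA', measureReal_restrict_apply hA,
    measureReal_restrict_apply hA', measureReal_def, measureReal_def, inter_comm, h F hF,
    inter_comm]

/-- Conditional stationarity, for the single interval `[0, d]` shifted to `t j.castSucc`, gives the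
increment the conditional law of `N d`, which is Poisson. -/
theorem IsMPP.condProb_increment_le (h : IsMPP P N Z) {m : ℕ} {t : Fin (m + 1) → ℝ≥0}
    (ht : IsTimeGrid t) (j : Fin m) (x : EReal) :
    condProb P Z {ω | increment N t j ω ≤ x} =ᵐ[P]
      fun ω => (poissonLaw ((Z ω).toNNReal * (t j.succ - t j.castSucc))).real (Iic x) := by
  have hlt : t j.castSucc < t j.succ := ht.2 Fin.castSucc_lt_succ
  set d := t j.succ - t j.castSucc with hd
  have hdpos : 0 < d := tsub_pos_of_lt hlt
  have hm : MeasurableSet {ω | increment N t j ω ≤ x} :=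
    h.counting.measurable_increment t j measurableSet_Iic
  have hm' : MeasurableSet {ω | N d ω ≤ x} := h.counting.measurable d measurableSet_Iic
  have h1 : condProb P Z {ω | increment N t j ω ≤ x} =ᵐ[P] condProb P Z {ω | N d ω ≤ x} := by
    refine condProb_ae_eq_of_forall_inter h.measurable hm hm' fun F hF => ?_
    have hB : MeasurableSet {f : Fin 1 → EReal | f 0 ≤ x} :=
      measurable_pi_apply 0 measurableSet_Iic
    have := h.cond_stationary 1 ![0, d] (isTimeGrid_pair hdpos) (t j.castSucc) F hF _ hB
    have e1 : ∀ ω, increment N (fun i => (![0, d] : Fin 2 → ℝ≥0) i + t j.castSucc) 0 ω =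
        increment N t j ω := fun ω => by
      simp [increment, hd, tsub_add_cancel_of_le hlt.le]
    simp only [mem_ofPred_eq, e1, h.counting.increment_pair] at this
    exact this
  obtain ⟨κ, hκ, T, -, hT0, hT⟩ := h.cond_law d hdpos
  have hTae : ∀ᵐ ω ∂P, ω ∉ T := measure_eq_zero_iff_ae_notMem.1 hT0
  filter_upwards [h1, hκ.ae_eq (Iic x) measurableSet_Iic, hTae] with ω e1 e2 e3
  have e4 : κ ω = poissonLaw ((Z ω).toNNReal * d) := hT ω e3
  rw [e1, ← e4, e2]
  rfl

/-- Conditional independence speaks only of events `≤ x`. Integrating it identifies the law on lower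
boxes, hence everywhere, and in particular at the integer points needed for the mixture formula. -/
theorem IsMPP.map_increments (h : IsMPP P N Z) {m : ℕ} {t : Fin (m + 1) → ℝ≥0}
    (ht : IsTimeGrid t) :
    P.map (fun ω j => increment N t j ω) = (P.map Z).bind fun y =>
      Measure.pi fun j => poissonLaw (y.toNNReal * (t j.succ - t j.castSucc)) := by
  have hκ := measurable_pi_poissonLaw fun j : Fin m => t j.succ - t j.castSucc
  have hinc := h.counting.measurable_increments t
  have : IsProbabilityMeasure (P.map fun ω j => increment N t j ω) :=
    Measure.isProbabilityMeasure_map hinc.aemeasurable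
  have : IsProbabilityMeasure (P.map Z) :=
    Measure.isProbabilityMeasure_map h.measurable.aemeasurable
  refine ext_of_generate_finite _ (generateFrom_lowerBoxes m) (isPiSystem_lowerBoxes m) ?_ ?_
  · rintro _ ⟨x, rfl⟩
    have hbox : MeasurableSet (Set.pi univ fun j => Iic (x j)) :=
      MeasurableSet.univ_pi fun j => measurableSet_Iic
    have hset : (fun ω j => increment N t j ω) ⁻¹' (Set.pi univ fun j => Iic (x j)) =
        ⋂ j ∈ (Finset.univ : Finset (Fin m)), {ω | increment N t j ω ≤ x j} := by
      ext ω; simp [Pi.le_def]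
    have hAm : MeasurableSet (⋂ j ∈ (Finset.univ : Finset (Fin m)),
        {ω | increment N t j ω ≤ x j}) := by
      rw [← hset]; exact hinc hbox
    simp only
    rw [Measure.map_apply hinc hbox, Measure.bind_apply hbox hκ.aemeasurable, hset,
      lintegral_map (Measure.measurable_measure.1 hκ _ hbox) h.measurable]
    have h1 : P.real (⋂ j ∈ (Finset.univ : Finset (Fin m)), {ω | increment N t j ω ≤ x j}) =
        ∫ ω, ∏ j,
          (poissonLaw ((Z ω).toNNReal * (t j.succ - t j.castSucc))).real (Iic (x j)) ∂P := by
      have h2 := integral_condExp (μ := P) (sigmaOf_le h.measurable)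
        (f := (⋂ j ∈ (Finset.univ : Finset (Fin m)),
          {ω | increment N t j ω ≤ x j}).indicator fun _ => (1 : ℝ))
      have h3 : ∫ ω, (⋂ j ∈ (Finset.univ : Finset (Fin m)),
          {ω | increment N t j ω ≤ x j}).indicator (fun _ => (1 : ℝ)) ω ∂P =
          P.real (⋂ j ∈ (Finset.univ : Finset (Fin m)), {ω | increment N t j ω ≤ x j}) :=
        integral_indicator_one hAm
      rw [← h3, ← h2]
      refine integral_congr_ae ?_
      have h4 : ∀ᵐ ω ∂P, ∀ j, condProb P Z {ω | increment N t j ω ≤ x j} ω =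
          (poissonLaw ((Z ω).toNNReal * (t j.succ - t j.castSucc))).real (Iic (x j)) :=
        ae_all_iff.2 fun j => h.condProb_increment_le ht j (x j)
      filter_upwards [h.cond_indep m t ht Finset.univ x, h4] with ω e1 e2
      simp only [e2] at e1
      exact e1
    rw [integral_eq_lintegral_of_nonneg_ae
      (Eventually.of_forall fun ω => Finset.prod_nonneg fun j _ => measureReal_nonneg)] at h1
    · refine (ENNReal.toReal_eq_toReal_iff' (measure_ne_top _ _) ?_).1 (h1.trans ?_)
      · refine ((lintegral_mono fun ω => prob_le_one).trans_lt ?_).ne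
        simp
      · congr 1
        refine lintegral_congr fun ω => ?_
        rw [Measure.pi_pi, ENNReal.ofReal_prod_of_nonneg fun j _ => measureReal_nonneg]
        exact Finset.prod_congr rfl fun j _ => ENNReal.ofReal_toReal (measure_ne_top _ _)
    · refine (Finset.measurable_prod _ fun j _ => ?_).aestronglyMeasurable
      exact ((measurable_poissonLaw_apply _ measurableSet_Iic).comp h.measurable).ennreal_toReal
  · rw [measure_univ, Measure.bind_apply MeasurableSet.univ hκ.aemeasurable]
    simp

/-- A process with conditionally Poisson increments is a mixture of Poisson processes. -/
theorem IsMPP.isMPPDistribution (h : IsMPP P N Z) : IsMPPDistribution P N (P.map Z) where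
  counting := h.counting
  prob := Measure.isProbabilityMeasure_map h.measurable.aemeasurable
  pos := h.pos
  mixture m t ht k := by
    have : IsProbabilityMeasure (P.map Z) :=
      Measure.isProbabilityMeasure_map h.measurable.aemeasurable
    have hU : ∀ᵐ y ∂P.map Z, 0 < y := (prob_compl_eq_zero_iff measurableSet_Ioi).2 h.pos
    have hκ := measurable_pi_poissonLaw fun j : Fin m => t j.succ - t j.castSucc
    have hset : (⋂ j, {ω | increment N t j ω = (k j : EReal)}) =
        (fun ω j => increment N t j ω) ⁻¹' {fun j => (k j : EReal)} := by
      ext ω; simp [funext_iff]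
    have hnn : ∀ y : ℝ, 0 < y → ∀ j : Fin m, 0 ≤ y * ((t j.succ : ℝ) - t j.castSucc) :=
      fun y hy j => mul_nonneg hy.le (sub_nonneg.2 (by
        exact_mod_cast ht.2.monotone Fin.castSucc_lt_succ.le))
    rw [hset, measureReal_def, ← Measure.map_apply (h.counting.measurable_increments t)
      (measurableSet_singleton _), h.map_increments ht,
      Measure.bind_apply (measurableSet_singleton _) hκ.aemeasurable,
      Measure.restrict_eq_self_of_ae_mem (s := Ioi 0) hU, integral_eq_lintegral_of_nonneg_ae]
    · congr 1
      refine lintegral_congr_ae ?_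
      filter_upwards [hU] with y hy
      change _ = ENNReal.ofReal (∏ j, poissonWeight (y * ((t j.succ : ℝ) - t j.castSucc)) (k j))
      rw [Measure.pi_singleton, ENNReal.ofReal_prod_of_nonneg fun j _ =>
        poissonWeight_nonneg (hnn y hy j) (k j)]
      refine Finset.prod_congr rfl fun j _ => ?_
      have hle : t j.castSucc ≤ t j.succ := ht.2.monotone Fin.castSucc_lt_succ.le
      rw [poissonLaw_singleton, NNReal.coe_mul, NNReal.coe_sub hle, Real.coe_toNNReal _ hy.le]
    · filter_upwards [hU] with y hy
      exact Finset.prod_nonneg fun j _ => poissonWeight_nonneg (hnn y hy j) (k j)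
    · refine (Finset.measurable_prod _ fun j _ => ?_).aestronglyMeasurable
      exact (measurable_poissonWeight (k j)).comp (measurable_id.mul_const _)

/-- A process that is a Poisson process under almost every measure of a consistent
disintegration has conditionally Poisson increments. -/
theorem isMPP_of_ae_isPoissonProcess (hN : IsCountingProcess N) (hZ : Measurable Z)
    (hQ : IsConsistentDisintegration P (P.map Z) Z univ Q)
    (h : ∀ᵐ y ∂P.map Z, IsPoissonProcess (Q y) N y) : IsMPP P N Z := by
  have : IsProbabilityMeasure (P.map Z) := Measure.isProbabilityMeasure_map hZ.aemeasurable
  have hprob : ∀ y, IsProbabilityMeasure (Q y) := fun y => hQ.prob y (mem_univ y)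
  have hω := ae_of_ae_map hZ.aemeasurable h
  have hcond := fun {A : Set Ω} (hA : MeasurableSet A) =>
    hQ.condProb_ae_eq hZ MeasurableSet.univ (fun ω => mem_univ (Z ω)) hA
  refine ⟨hN, hZ, ?_, fun m t ht s x => ?_, fun m t ht u F hF B hB => ?_, fun t ht => ?_⟩
  · refine (prob_compl_eq_zero_iff measurableSet_Ioi).1 ?_
    have : ∀ᵐ y ∂P.map Z, 0 < y := h.mono fun y hy => hy.pos
    exact this
  · have hm : ∀ j, MeasurableSet {ω | increment N t j ω ≤ x j} := fun j =>
      hN.measurable_increment t j measurableSet_Iic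
    have h1 : ∀ᵐ ω ∂P, ∀ j, condProb P Z {ω | increment N t j ω ≤ x j} ω =
        (Q (Z ω)).real {ω | increment N t j ω ≤ x j} := ae_all_iff.2 fun j => hcond (hm j)
    filter_upwards [hω, hcond (Finset.measurableSet_biInter s fun j _ => hm j), h1] with ω e1 e2 e3
    rw [e2]
    simp_rw [e3]
    have := iIndepFun_iff_measure_inter_preimage_eq_mul.1 (e1.indep m t ht) s
      (sets := fun j => Iic (x j)) fun j _ => measurableSet_Iic
    simp only [measureReal_def, ← ENNReal.toReal_prod]
    exact congrArg ENNReal.toReal this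
  · obtain ⟨C, hC, rfl⟩ := hF
    have hm : ∀ t : Fin (m + 1) → ℝ≥0, MeasurableSet {ω | (fun j => increment N t j ω) ∈ B} :=
      fun t => hN.measurable_increments t hB
    rw [hQ.measure_inter hZ MeasurableSet.univ (fun ω => mem_univ (Z ω)) (hm _) hC,
      hQ.measure_inter hZ MeasurableSet.univ (fun ω => mem_univ (Z ω)) (hm _) hC]
    refine lintegral_congr_ae (ae_restrict_of_ae ?_)
    filter_upwards [hω] with ω e1
    exact (e1.stationary m t ht u).measure_mem_eq hB
  · refine ⟨fun ω => poissonLaw ((Z ω).toNNReal * t), ⟨fun ω => inferInstance, fun B hB => ?_,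
      fun B hB => ?_⟩, ∅, @MeasurableSet.empty _ (sigmaOf Z), measure_empty, fun _ _ => rfl⟩
    · exact (measurable_poissonLaw_apply t hB).comp (comap_measurable Z)
    · filter_upwards [hω, hcond (hN.measurable t hB)] with ω e1 e2
      rw [e2, ← e1.law t ht]
      simp only [measureReal_def]
      rw [Measure.map_apply (hN.measurable t) hB]

end Equivalences

/-! ### Exponential interarrival times under almost every `Q y`. -/

section Exponential

variable {Ω : Type*} [MeasurableSpace Ω] {P : Measure Ω}
  {N : ℝ≥0 → Ω → EReal} {Z : Ω → ℝ} {Q : ℝ → Measure Ω}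

/-- Because the laws under `Q y` are identical, joint survival probabilities of several interarrival
times become mixed moments of the survival function of the first one alone. -/
theorem integral_prod_interarrival_gt (hN : IsCountingProcess N) {U : Measure ℝ}
    (hQ : IsDisintegration P U univ Q)
    (hiid : ∀ᵐ y ∂U, iIndepFun (interarrival N) (Q y) ∧
      ∀ n, (Q y).map (interarrival N n) = (Q y).map (interarrival N 0)) (n : ℕ) (a : ℕ → ℝ) :
    ∫ y, ∏ i ∈ Finset.range n, (Q y).real {ω | a i < interarrival N 0 ω} ∂U =
      P.real (⋂ i ∈ Finset.range n, {ω | a i < interarrival N i ω}) := by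
  have hprob : ∀ y, IsProbabilityMeasure (Q y) := fun y => hQ.prob y (mem_univ y)
  have hm : ∀ i j, MeasurableSet {ω | a i < interarrival N j ω} := fun i j =>
    measurableSet_lt measurable_const (hN.measurable_interarrival j)
  have hA := Finset.measurableSet_biInter (Finset.range n) fun i _ => hm i i
  have h1 := hQ.lintegral_eq _ hA
  rw [Measure.restrict_univ] at h1
  rw [measureReal_def, ← h1, integral_eq_lintegral_of_nonneg_ae]
  · congr 1
    refine lintegral_congr_ae ?_
    filter_upwards [hiid] with y ⟨hind, hlaw⟩
    have h2 := iIndepFun_iff_measure_inter_preimage_eq_mul.1 hind (Finset.range n)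
      (sets := fun i => Ioi (a i)) fun i _ => measurableSet_Ioi
    change Q y (⋂ i ∈ Finset.range n, {ω | a i < interarrival N i ω}) = _ at h2
    rw [h2, ENNReal.ofReal_prod_of_nonneg fun i _ => measureReal_nonneg]
    refine Finset.prod_congr rfl fun i _ => ?_
    have h3 : Q y (interarrival N i ⁻¹' Ioi (a i)) = Q y (interarrival N 0 ⁻¹' Ioi (a i)) := by
      rw [← Measure.map_apply (hN.measurable_interarrival i) measurableSet_Ioi, hlaw i,
        Measure.map_apply (hN.measurable_interarrival 0) measurableSet_Ioi]
    rw [h3]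
    exact ENNReal.ofReal_toReal (measure_ne_top _ _)
  · exact Eventually.of_forall fun y => Finset.prod_nonneg fun i _ => measureReal_nonneg
  · exact (Finset.measurable_prod _ fun i _ =>
      (hQ.measurable_univ (hm i 0)).ennreal_toReal).aestronglyMeasurable

/-- The first interarrival time is positive on every path, so its distribution function vanishes at
`0`; right-continuity does the rest. -/
theorem tendsto_survival (hN : IsCountingProcess N) (q : Measure Ω) [IsProbabilityMeasure q] :
    Tendsto (fun t : ℝ => q.real {ω | t < interarrival N 0 ω}) (𝓝[>] 0) (𝓝 1) := by
  have hW := hN.measurable_interarrival 0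
  have : IsProbabilityMeasure (q.map (interarrival N 0)) :=
    Measure.isProbabilityMeasure_map hW.aemeasurable
  have hcdf : ∀ t : ℝ, q.real {ω | t < interarrival N 0 ω} =
      1 - cdf (q.map (interarrival N 0)) t := fun t => by
    rw [cdf_eq_real, map_measureReal_apply hW measurableSet_Iic, ← probReal_compl_eq_one_sub
      (hW measurableSet_Iic)]
    congr 1
    ext ω; simp
  have h0 : cdf (q.map (interarrival N 0)) 0 = 0 := by
    rw [cdf_eq_real, map_measureReal_apply hW measurableSet_Iic]
    have : interarrival N 0 ⁻¹' Iic 0 = ∅ := by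
      ext ω; simpa using hN.interarrival_pos 0 ω
    rw [this, measureReal_empty]
  have hrc := (cdf (q.map (interarrival N 0))).right_continuous 0
  have hlim : Tendsto (cdf (q.map (interarrival N 0))) (𝓝[>] 0) (𝓝 0) := by
    have := hrc.tendsto.mono_left (nhdsWithin_mono 0 Ioi_subset_Ici_self)
    rwa [h0] at this
  simp_rw [hcdf]
  simpa using hlim.const_sub 1

theorem survival_eq_one_sub (hN : IsCountingProcess N) (q : Measure Ω) [IsProbabilityMeasure q]
    (t : ℝ) : q.real {ω | t < interarrival N 0 ω} =
      1 - q.real {ω | interarrival N 0 ω ≤ t} := by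
  rw [← probReal_compl_eq_one_sub (measurableSet_le (hN.measurable_interarrival 0)
    measurable_const)]
  congr 1
  ext ω; simp

/-- If the interarrival times are independent and identically distributed under almost every
`Q y`, with a density that tends to `y` at `0`, and if the process is a mixed Poisson process, then
the interarrival times are exponential with parameter `y` under almost every `Q y`. -/
theorem ae_exponential_of_isMPPDistribution [IsProbabilityMeasure P] {U : Measure ℝ}
    (hQ : IsDisintegration P U univ Q)
    (hiid : ∀ᵐ y ∂U, iIndepFun (interarrival N) (Q y) ∧
      ∀ n, (Q y).map (interarrival N n) = (Q y).map (interarrival N 0))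
    (hdens : ∀ᵐ y ∂U, 0 < y ∧
      (∀ t, 0 < t → DifferentiableAt ℝ (fun t => (Q y).real {ω | interarrival N 0 ω ≤ t}) t) ∧
      Tendsto (deriv fun t => (Q y).real {ω | interarrival N 0 ω ≤ t}) (𝓝[>] 0) (𝓝 y))
    (h : IsMPPDistribution P N U) :
    ∀ᵐ y ∂U, 0 < y ∧ iIndepFun (interarrival N) (Q y) ∧
      ∀ n, (Q y).map (interarrival N n) = expMeasure y := by
  have hN := h.counting
  have := h.prob
  have hprob : ∀ y, IsProbabilityMeasure (Q y) := fun y => hQ.prob y (mem_univ y)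
  set G : ℝ → ℝ → ℝ := fun y t => (Q y).real {ω | t < interarrival N 0 ω} with hG
  have hGm : ∀ t, Measurable fun y => G y t := fun t =>
    (hQ.measurable_univ (measurableSet_lt measurable_const
      (hN.measurable_interarrival 0))).ennreal_toReal
  have hinteg : ∀ (n : ℕ) (a : ℕ → ℝ), (∀ i, 0 ≤ a i) →
      ∫ y, ∏ i ∈ Finset.range n, G y (a i) ∂U =
        ∫ y, ∏ i ∈ Finset.range n, Real.exp (-(y * a i)) ∂U := fun n a ha => by
    rw [← h.measure_interarrival_gt n ha]
    exact integral_prod_interarrival_gt hN hQ hiid n a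
  -- So far `G` and the exponentials share only their mixed moments under `U`. A vanishing second
  -- moment turns this into an identity for almost every `y`.
  have hmul : ∀ᵐ y ∂U, ∀ s t : ℚ, 0 < s → 0 < t → G y (s + t) = G y s * G y t := by
    refine ae_all_iff.2 fun s => ae_all_iff.2 fun t => ?_
    by_cases hs : 0 < s
    swap
    · exact Eventually.of_forall fun y h => absurd h hs
    by_cases ht : 0 < t
    swap
    · exact Eventually.of_forall fun y _ h => absurd h ht
    have hs' : (0 : ℝ) < s := by exact_mod_cast hs
    have ht' : (0 : ℝ) < t := by exact_mod_cast ht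
    have hexpm : ∀ c : ℝ, Measurable fun y : ℝ => Real.exp (-(y * c)) := fun c => by fun_prop
    have hexpI : ∀ y : ℝ, 0 < y → ∀ c : ℝ, 0 < c → Real.exp (-(y * c)) ∈ Icc (0 : ℝ) 1 :=
      fun y hy c hc => ⟨(Real.exp_pos _).le, Real.exp_le_one_iff.2 (by
        have := mul_pos hy hc; linarith)⟩
    have key := ae_eq_mul_of_integral_eq (μ := U) (a := fun y => G y (s + t))
      (b := fun y => G y s) (c := fun y => G y t)
      (a' := fun y => Real.exp (-(y * (s + t)))) (b' := fun y => Real.exp (-(y * s)))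
      (c' := fun y => Real.exp (-(y * t))) (hGm _) (hGm _) (hGm _) (hexpm _) (hexpm _) (hexpm _)
      (Eventually.of_forall fun y => ⟨⟨measureReal_nonneg, measureReal_le_one⟩,
        ⟨measureReal_nonneg, measureReal_le_one⟩, ⟨measureReal_nonneg, measureReal_le_one⟩⟩)
      (h.ae_pos.mono fun y hy => ⟨hexpI y hy _ (add_pos hs' ht'), hexpI y hy _ hs',
        hexpI y hy _ ht'⟩) ?_ ?_ ?_ (fun y => by rw [← Real.exp_add]; congr 1; ring)
    · filter_upwards [key] with y hy _ _ using hy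
    -- The three moments are the joint survival probabilities of two, three and four interarrival
    -- times, with thresholds `s + t, s + t`, then `s + t, s, t`, then `s, s, t, t`.
    · have := hinteg 2 (fun _ => s + t) fun _ => (add_pos hs' ht').le
      simpa only [Finset.prod_range_succ, Finset.prod_range_zero, one_mul] using this
    · have := hinteg 3 (fun i => if i = 0 then (s : ℝ) + t else if i = 1 then (s : ℝ) else t)
        fun i => by split_ifs <;> linarith
      simpa [Finset.prod_range_succ] using this
    · have := hinteg 4 (fun i => if i < 2 then (s : ℝ) else t)
        fun i => by split_ifs <;> linarith
      simpa [Finset.prod_range_succ] using this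
  filter_upwards [hiid, hdens, hmul] with y ⟨hind, hlaw⟩ ⟨hy, hdiff, hlim⟩ hmul
  refine ⟨hy, hind, fun n => ?_⟩
  have hGeq : G y = fun t => 1 - (Q y).real {ω | interarrival N 0 ω ≤ t} :=
    funext (survival_eq_one_sub hN (Q y))
  have hexp : ∀ t, 0 < t → G y t = Real.exp (-(y * t)) := fun t ht => by
    refine eq_exp_of_mul (tendsto_survival hN (Q y)) (fun t ht => ?_) ?_ hmul ht
    · change DifferentiableAt ℝ (G y) t
      rw [hGeq]
      exact (hdiff t ht).const_sub 1
    · change Tendsto (deriv (G y)) _ _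
      rw [hGeq]
      have : (deriv fun t => 1 - (Q y).real {ω | interarrival N 0 ω ≤ t}) =
          fun t => -deriv (fun t => (Q y).real {ω | interarrival N 0 ω ≤ t}) t :=
        funext fun t => deriv_const_sub 1
      rw [this]
      exact hlim.neg
  have hW := hN.measurable_interarrival 0
  have : IsProbabilityMeasure ((Q y).map (interarrival N 0)) :=
    Measure.isProbabilityMeasure_map hW.aemeasurable
  rw [hlaw n]
  refine eq_expMeasure_of_Ioi hy fun q hq => ?_
  rw [Measure.map_apply hW measurableSet_Ioi]
  rcases hq.eq_or_lt with rfl | hq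
  · have : interarrival N 0 ⁻¹' Ioi ((0 : ℚ) : ℝ) = univ := by
      ext ω; simpa using hN.interarrival_pos 0 ω
    rw [this, measure_univ]
    simp
  · rw [← hexp q (by exact_mod_cast hq)]
    exact (ENNReal.ofReal_toReal (measure_ne_top _ _)).symm

theorem measure_interarrival_gt_of_exponential (hN : IsCountingProcess N) {q : Measure Ω}
    {r : ℝ} (hr : 0 < r) {n : ℕ} (hlaw : q.map (interarrival N n) = expMeasure r) {t : ℝ}
    (ht : 0 ≤ t) :
    q {ω | t < interarrival N n ω} = ENNReal.ofReal (Real.exp (-(r * t))) := by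
  rw [← expMeasure_Ioi hr ht, ← hlaw,
    Measure.map_apply (hN.measurable_interarrival n) measurableSet_Ioi]
  rfl

/-- The parameter of an exponential law is the limit of the density at `0`. -/
theorem eq_of_tendsto_deriv (hN : IsCountingProcess N) {q : Measure Ω} [IsProbabilityMeasure q]
    {r y : ℝ} (hr : 0 < r) (hlaw : q.map (interarrival N 0) = expMeasure r)
    (hlim : Tendsto (deriv fun t => q.real {ω | interarrival N 0 ω ≤ t}) (𝓝[>] 0) (𝓝 y)) :
    r = y := by
  have hF : ∀ t, 0 < t → q.real {ω | interarrival N 0 ω ≤ t} = 1 - Real.exp (-(r * t)) :=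
    fun t ht => by
      have h1 := survival_eq_one_sub hN q t
      rw [measureReal_def, measure_interarrival_gt_of_exponential hN hr hlaw ht.le,
        ENNReal.toReal_ofReal (Real.exp_pos _).le] at h1
      linarith
  have hd : ∀ t, 0 < t → deriv (fun t => q.real {ω | interarrival N 0 ω ≤ t}) t =
      r * Real.exp (-(r * t)) := fun t ht => by
    have h1 : (fun t => q.real {ω | interarrival N 0 ω ≤ t}) =ᶠ[𝓝 t]
        fun t => 1 + -Real.exp (-(r * t)) := by
      filter_upwards [lt_mem_nhds ht] with u hu
      rw [hF u hu]; ring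
    rw [h1.deriv_eq]
    exact (hasDerivAt_neg_exp_mul_exp.const_add 1).deriv
  have h2 : Tendsto (fun t => r * Real.exp (-(r * t))) (𝓝[>] 0) (𝓝 (r * Real.exp (-(r * 0)))) := by
    have : Continuous fun t => r * Real.exp (-(r * t)) := by fun_prop
    exact (this.tendsto 0).mono_left nhdsWithin_le_nhds
  have h3 := h2.congr' (f₂ := deriv fun t => q.real {ω | interarrival N 0 ω ≤ t}) (by
    filter_upwards [self_mem_nhdsWithin] with t ht using (hd t ht).symm)
  simpa using tendsto_nhds_unique h3 hlim

theorem familySigma_le (hQ : ∀ A, MeasurableSet A → Measurable fun y => Q y A) :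
    familySigma Q ≤ (inferInstance : MeasurableSpace ℝ) :=
  iSup_le fun E => (hQ E E.2).comap_le

theorem measurable_familySigma {A : Set Ω} (hA : MeasurableSet A) :
    Measurable[familySigma Q] fun y => Q y A :=
  measurable_iff_comap_le.2
    (le_iSup (fun E : {E : Set Ω // MeasurableSet E} =>
      MeasurableSpace.comap (fun y => Q y E) inferInstance) ⟨A, hA⟩)

/-- The mixing measure is the law of `Z` trimmed to `familySigma Q`, so its null sets are null for
the Borel law as well. The limit of the density at `0` then forces `α y = y`. -/
theorem ae_exponential_of_isMPPFamily (hZ : Measurable Z)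
    (hQ : IsDisintegration P (P.map Z) univ Q)
    (hdens : ∀ᵐ y ∂P.map Z, 0 < y ∧
      (∀ t, 0 < t → DifferentiableAt ℝ (fun t => (Q y).real {ω | interarrival N 0 ω ≤ t}) t) ∧
      Tendsto (deriv fun t => (Q y).real {ω | interarrival N 0 ω ≤ t}) (𝓝[>] 0) (𝓝 y))
    (h : IsMPPFamily P N Q (@Measure.map Ω ℝ _ (familySigma Q) Z P)) :
    ∀ᵐ y ∂P.map Z, 0 < y ∧ iIndepFun (interarrival N) (Q y) ∧
      ∀ n, (Q y).map (interarrival N n) = expMeasure y := by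
  have hle := familySigma_le fun A hA => hQ.measurable_univ (A := A) hA
  have htrim : @Measure.map Ω ℝ _ (familySigma Q) Z P = (P.map Z).trim hle := by
    rw [trim_eq_map, @Measure.map_map Ω ℝ ℝ _ _ (familySigma Q) P id Z
      (measurable_id'' hle) hZ, Function.id_comp]
  obtain ⟨α, hα, -, hae⟩ := h.exponential
  rw [htrim] at hae
  filter_upwards [ae_of_ae_trim hle hae, hdens] with y ⟨hind, hlaw⟩ ⟨hy, _, hlim⟩
  have := hQ.prob y (mem_univ y)
  rw [eq_of_tendsto_deriv h.counting (hα y) (hlaw 0) hlim] at hlaw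
  exact ⟨hy, hind, hlaw⟩

/-- The parameter must be measurable for `familySigma Q`, which the identity need not be; `-log (Q y
{W₁ > 1})` is, and it equals `y` almost surely. For the same reason the exponential law is expressed
through `α y`, by countably many conditions that define sets in `familySigma Q`. -/
theorem isMPPFamily_of_ae_exponential [IsProbabilityMeasure P] (hN : IsCountingProcess N)
    (hZ : Measurable Z) (hQ : IsDisintegration P (P.map Z) univ Q)
    (h : ∀ᵐ y ∂P.map Z, 0 < y ∧ iIndepFun (interarrival N) (Q y) ∧
      ∀ n, (Q y).map (interarrival N n) = expMeasure y) :
    IsMPPFamily P N Q (@Measure.map Ω ℝ _ (familySigma Q) Z P) := by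
  have hprob : ∀ y, IsProbabilityMeasure (Q y) := fun y => hQ.prob y (mem_univ y)
  have hle := familySigma_le fun A hA => hQ.measurable_univ (A := A) hA
  have hZ' : @Measurable Ω ℝ _ (familySigma Q) Z := hZ.mono le_rfl hle
  have hω := ae_of_ae_map hZ.aemeasurable h
  have hWm := hN.measurable_interarrival
  have hgt : ∀ (t : ℝ) (n : ℕ), MeasurableSet {ω | t < interarrival N n ω} := fun t n =>
    measurableSet_lt measurable_const (hWm n)
  set β : ℝ → ℝ := fun y => -Real.log (Q y {ω | 1 < interarrival N 0 ω}).toReal with hβ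
  have hβm : Measurable[familySigma Q] β :=
    (Real.measurable_log.comp (measurable_familySigma (hgt 1 0)).ennreal_toReal).neg
  -- The value `1` makes `α` positive everywhere; it is used only on a null set.
  set α : ℝ → ℝ := fun y => if 0 < β y then β y else 1 with hα
  have hαpos : ∀ y, 0 < α y := fun y => by
    simp only [hα]; split_ifs with hy
    exacts [hy, one_pos]
  have hαm : Measurable[familySigma Q] α :=
    Measurable.ite (hβm measurableSet_Ioi) hβm measurable_const
  have hαω : ∀ᵐ ω ∂P, α (Z ω) = Z ω := by
    filter_upwards [hω] with ω ⟨hpos, _, hlaw⟩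
    have : β (Z ω) = Z ω := by
      simp only [hβ]
      rw [measure_interarrival_gt_of_exponential hN hpos (hlaw 0) zero_le_one,
        ENNReal.toReal_ofReal (Real.exp_pos _).le, Real.log_exp, mul_one, neg_neg]
    simp only [hα, this, if_pos hpos]
  refine ⟨hN, hprob, ?_, ⟨α, hαpos, hαm, ?_⟩, fun r w _ => ?_⟩
  · rw [@Measure.map_apply Ω ℝ _ (familySigma Q) P Z hZ' univ
      (@MeasurableSet.univ _ (familySigma Q)),
      preimage_univ, measure_univ]
  · refine Eventually.and ?_ ?_
    · refine @ae_map_iIndepFun Ω _ P ℝ (familySigma Q) Z Q hZ'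
        (fun A hA => measurable_familySigma hA) _ hWm fun s x => ?_
      filter_upwards [hω] with ω ⟨_, hind, _⟩
      have := iIndepFun_iff_measure_inter_preimage_eq_mul.1
        (hind.precomp (Subtype.val_injective (p := fun i => i ∈ s))) Finset.univ
        (sets := fun i => Iic (x i : ℝ)) fun i _ => measurableSet_Iic
      simp only [Finset.mem_univ, iInter_true] at this
      exact this
    · have hall : ∀ᵐ y ∂(@Measure.map Ω ℝ _ (familySigma Q) Z P), ∀ (n : ℕ) (q : ℚ), 0 ≤ q →
          Q y {ω | (q : ℝ) < interarrival N n ω} =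
            ENNReal.ofReal (Real.exp (-(α y * q))) := by
        refine ae_all_iff.2 fun n => ae_all_iff.2 fun q => ?_
        by_cases hq : 0 ≤ q
        swap
        · exact Eventually.of_forall fun y h => absurd h hq
        have hms : MeasurableSet[familySigma Q] {y | Q y {ω | (q : ℝ) < interarrival N n ω} =
            ENNReal.ofReal (Real.exp (-(α y * q)))} :=
          @measurableSet_eq_fun ℝ ℝ≥0∞ (familySigma Q) _ _ _ _ (measurable_familySigma (hgt _ n))
            ((by fun_prop : Measurable fun a : ℝ =>
              ENNReal.ofReal (Real.exp (-(a * q)))).comp hαm)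
        have := (@ae_map_iff Ω ℝ _ (familySigma Q) P Z
          (@Measurable.aemeasurable Ω ℝ _ (familySigma Q) Z P hZ') _ hms).2 (by
          filter_upwards [hω, hαω] with ω ⟨hpos, _, hlaw⟩ e
          rw [e]
          exact measure_interarrival_gt_of_exponential hN hpos (hlaw n) (by exact_mod_cast hq))
        filter_upwards [this] with y hy _ using hy
      filter_upwards [hall] with y hy n
      have : IsProbabilityMeasure ((Q y).map (interarrival N n)) :=
        Measure.isProbabilityMeasure_map (hWm n).aemeasurable
      refine eq_expMeasure_of_Ioi (hαpos y) fun q hq => ?_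
      rw [Measure.map_apply (hWm n) measurableSet_Ioi]
      exact hy n q hq
  · have hle' : ∀ k : Fin r, MeasurableSet {ω | interarrival N k ω ≤ w k} := fun k =>
      measurableSet_le (hWm k) measurable_const
    rw [@lintegral_map Ω ℝ _ (familySigma Q) P _ Z (Finset.measurable_prod _ fun k _ =>
      measurable_familySigma (hle' k)) hZ',
      ← hQ.lintegral_comp hZ MeasurableSet.univ (fun ω => mem_univ (Z ω))
        (MeasurableSet.iInter hle')]
    refine lintegral_congr_ae ?_
    filter_upwards [hω] with ω ⟨_, hind, _⟩
    have := iIndepFun_iff_measure_inter_preimage_eq_mul.1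
      (hind.precomp (Fin.val_injective (n := r))) Finset.univ
      (sets := fun k => Iic (w k)) fun k _ => measurableSet_Iic
    simp only [Finset.mem_univ, iInter_true] at this
    exact this

end Exponential

end MixedPoisson

end

/-! ### The cycle of implications. -/

open MixedPoisson in
theorem theorem2p2 {Ω : Type*} [MeasurableSpace Ω] (P : Measure Ω) [IsProbabilityMeasure P]
    (N : ℝ≥0 → Ω → EReal) (Θ : Ω → ℝ) (hΘ : Measurable Θ) (D : Set ℝ) (h : ℝ → ℝ)
    (K : ℝ → Measure ℝ) (hN : MixedPoisson.IsEMRP P N Θ D h K)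
    (R : ℝ → Measure Ω)
    (hR : MixedPoisson.IsConsistentDisintegration P (P.map Θ) Θ D R)
    (Lh : Set ℝ) (hLh : MixedPoisson.DensityAssumption P N Θ D h R Lh)
    (L0 : Set ℝ) (hL0D : L0 ⊆ D) (hL0m : MeasurableSet L0) (hL0 : P.map Θ L0 = 0)
    (hinj : InjOn h (D \ L0))
    (Θhat : Ω → ℝ) (hΘhatm : Measurable Θhat)
    (hΘhat : ∀ ω, Θ ω ∈ D \ (L0 ∪ Lh) → Θhat ω = MixedPoisson.initialDensity N R (Θ ω))
    (Q : ℝ → Measure Ω)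
    (hQ : Q = MixedPoisson.transport P R (MixedPoisson.initialDensity N R) (D \ (L0 ∪ Lh))) :
    MixedPoisson.IsConsistentDisintegration P (P.map Θhat) Θhat univ Q ∧
    List.TFAE [
      MixedPoisson.IsMPP P N Θhat,
      MixedPoisson.IsMPPFamily P N Q
        (@Measure.map Ω ℝ _ (MixedPoisson.familySigma Q) Θhat P),
      ∀ᵐ y ∂(P.map Θhat), MixedPoisson.IsPoissonProcess (Q y) N y,
      MixedPoisson.IsMPPDistribution P N (P.map Θhat)] := by
  set S : Set ℝ := D \ (L0 ∪ Lh) with hS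
  have hSm : MeasurableSet S := hN.measurableSet.diff (hL0m.union hLh.measurableSet)
  have hSD : S ⊆ D := sdiff_subset
  have hSL : S ⊆ D \ Lh := sdiff_subset_sdiff_right subset_union_right
  have hSae : ∀ᵐ ω ∂P, Θ ω ∈ S := by
    have h0 : P.map Θ (L0 ∪ Lh) = 0 := measure_union_null hL0 hLh.null
    rw [Measure.map_apply hΘ (hL0m.union hLh.measurableSet)] at h0
    filter_upwards [measure_eq_zero_iff_ae_notMem.1 h0] with ω hω
    exact ⟨hN.range_subset ω, hω⟩
  have hdiff : ∀ θ ∈ S, ∀ t, 0 < t → DifferentiableAt ℝ (interarrivalCDF N R θ) t :=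
    fun θ hθ t ht => ((hLh.contDiff θ (hSL hθ)).differentiableOn one_ne_zero).differentiableAt
      (Ioi_mem_nhds ht)
  have hp : Measurable (S.indicator (initialDensity N R)) :=
    measurable_indicator_initialDensity hN.counting hR.toIsDisintegration hSm hSD hdiff
      fun θ hθ => hLh.tendsto θ (hSL hθ)
  have hpinj : InjOn (initialDensity N R) S := hLh.injective.mono hSL
  have hQR : ∀ θ ∈ S, Q (initialDensity N R θ) = R θ := fun θ hθ => by
    rw [hQ]; exact transport_apply hpinj hθ
  have hdis : IsConsistentDisintegration P (P.map Θhat) Θhat univ Q := by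
    rw [hQ]
    exact isConsistentDisintegration_transport hR hΘ hN.measurableSet hN.range_subset hSm hSD
      hSae hp hpinj hΘhatm hΘhat
  have hiid := hN.ae_iid hR hΘ hΘhatm hdis (by
    filter_upwards [hSae] with ω hω
    rw [hΘhat ω hω, hQR _ hω])
  -- Almost every `y` is `initialDensity N R θ` with `θ ∈ S`, and there `Q y = R θ`; after the
  -- change of parameter the initial density under `Q y` is `y` itself.
  have hdens : ∀ᵐ y ∂P.map Θhat, 0 < y ∧
      (∀ t, 0 < t → DifferentiableAt ℝ (fun t => (Q y).real {ω | interarrival N 0 ω ≤ t}) t) ∧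
      Tendsto (deriv fun t => (Q y).real {ω | interarrival N 0 ω ≤ t}) (𝓝[>] 0) (𝓝 y) := by
    have him : ∀ᵐ y ∂P.map Θhat, y ∈ initialDensity N R '' S := by
      refine (ae_map_iff (p := fun y => y ∈ initialDensity N R '' S) hΘhatm.aemeasurable
        (measurableSet_image_of_indicator hp hpinj hSm Subset.rfl)).2 ?_
      filter_upwards [hSae] with ω hω
      exact ⟨Θ ω, hω, (hΘhat ω hω).symm⟩
    filter_upwards [him] with y hy
    obtain ⟨θ, hθ, rfl⟩ := hy
    rw [hQR θ hθ]
    exact ⟨hLh.pos θ (hSL hθ), hdiff θ hθ, hLh.tendsto θ (hSL hθ)⟩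
  refine ⟨hdis, ?_⟩
  have hexp4 := ae_exponential_of_isMPPDistribution hdis.toIsDisintegration hiid hdens
  tfae_have 1 → 4 := fun h1 => h1.isMPPDistribution
  tfae_have 4 → 2 := fun h4 =>
    isMPPFamily_of_ae_exponential hN.counting hΘhatm hdis.toIsDisintegration (hexp4 h4)
  tfae_have 2 → 3 := fun h2 => by
    filter_upwards [ae_exponential_of_isMPPFamily hΘhatm hdis.toIsDisintegration hdens h2]
      with y ⟨hy, hind, hlaw⟩
    have := hdis.prob y (mem_univ y)
    exact isPoissonProcess_of_exponential hN.counting hy hind hlaw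
  tfae_have 3 → 1 := isMPP_of_ae_isPoissonProcess hN.counting hΘhatm hdis
  tfae_finish
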